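/- A \emph{partial E-field} $F$ consists of a field $F$ of characteristic $0$, a $\mathbb{Q}$-vector space $D=D(F)$ with an injective additive map $D\to F$ (by which $D$ is regarded as a subset of $F$), and a homomorphism $x\mapsto e^x$ from $(D,+)$ to $F^\times$. Write $\ker(F)=\{x\in D: e^x=1\}$. $F$ has \emph{strong kernel} if for every finite tuple $\bar x=(x_1,\dots,x_n)$ from $D$ $$\Delta_F(\bar x)=\mathrm{td}(\bar x,e^{\bar x}/\ker(F))-\mathrm{ldim}_{\mathbb{Q}}(\bar x/\ker(F))\ \ge\ 0,$$ where $\mathrm{td}(Y/X)$ is the transcendence degree of $\mathbb{Q}(X\cup Y)$ over $\mathbb{Q}(X)$ and $\mathrm{ldim}_{\mathbb{Q}}(Y/X)$ is the dimension of $\mathrm{span}_{\mathbb Q}(X\cup Y)/\mathrm{span}_{\mathbb Q}(X)$. Varieties below are Zariski closed sets, possibly reducible, of points over the algebraic closure of $F$. Let $G^n=\mathbb{G}_a^n\times\mathbb{G}_m^n$, with projection $\mathrm{pr}:G^n\to\mathbb{G}_m^n$. * For $V\subseteq G^n$ irreducible, $V^{gf}=\{v\in V:\dim (V\cap \mathrm{pr}^{-1}(\mathrm{pr}(v)))=\dim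 V-\dim \mathrm{pr}(V)\}$. For $V$ reducible, $V^{gf}$ is the union of the $W^{gf}$ over the irreducible components $W$ of $V$. * For $W\subseteq\mathbb{G}_m^n$ irreducible and closed, $W^{atyp}$ is the union, over all algebraic subgroups $H\subseteq\mathbb{G}_m^n$, of the connected components $X$ of $W\cap H$ with $\dim X>\dim W+\dim H-n$. * For $V\subseteq G^n$ irreducible, $\mathrm{pr}(V)^{atyp}$ means $\bigl(\overline{\mathrm{pr}(V)}\bigr)^{atyp}$, with the Zariski closure in $\mathbb{G}_m^n$. For $V$ reducible, $\mathrm{pr}(V)^{atyp}$ means the union of the $\mathrm{pr}(W)^{atyp}$ over the irreducible components $W$ of $V$. The \emph{Strong Kernel scheme} consists, for all $n,m\in\mathbb{N}$ and every subvariety $\mathcal V\subseteq G^n\times\mathbb{A}^m$ defined over $\mathbb{Q}$, with fibres $V_{\bar p}\subseteq G^n$ for $\bar p\in\mathbb{A}^m$, of the axiom $$(\forall \bar k\in\ker(F)^m)(\forall \bar x\in D^n)\ \bigl[\dim V_{\bar k}\ge n\ \vee\ (\bar x,e^{\bar x})\notin V_{\bar k}^{gf}\ \vee\ e^{\bar x}\in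 \mathrm{pr}(V_{\bar k})^{atyp}\bigr].$$ **Proposition.** Let $F$ be a partial E-field. Then $F$ has strong kernel if and only if $F$ satisfies the Strong Kernel scheme. -/

import Mathlib

open MvPolynomial

noncomputable section

namespace EField

/-! ### Partial exponential fields and the predimension relative to the kernel -/

/-- A partial E-field: a field `F` of characteristic zero, a `ℚ`-vector space `D` (the domain of
exponentiation), an injective additive map `D → F` and a homomorphism `exp` from the additive
group of `D` to the multiplicative group of `F`. -/
structure PartialEField (F D : Type*) [Field F] [CharZero F] [AddCommGroup D] [Module ℚ D] where
  incl : D →+ F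
  incl_injective : Function.Injective incl
  exp : Multiplicative D →* Fˣ

/-- `ldim_ℚ(Y / X)`: the dimension of the image of the span of `X ∪ Y` in the quotient by the
span of `X`. -/
def ldim {D : Type*} [AddCommGroup D] [Module ℚ D] (Y X : Set D) : ℕ :=
  Module.finrank ℚ (Submodule.map (Submodule.span ℚ X).mkQ (Submodule.span ℚ (X ∪ Y)))

/-- `td(Y / X)`: the transcendence degree of the field extension `ℚ(X)(Y) / ℚ(X)` (it is used
for finite `Y` only, where it is finite). -/
def td {F : Type*} [Field F] [CharZero F] (Y X : Set F) : ℕ :=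
  Cardinal.toNat (Algebra.trdeg (IntermediateField.adjoin ℚ X)
    (IntermediateField.adjoin (IntermediateField.adjoin ℚ X) Y))

namespace PartialEField

variable {F D : Type*} [Field F] [CharZero F] [AddCommGroup D] [Module ℚ D]

/-- The exponential of `x`, as a unit of `F`. -/
def e (E : PartialEField F D) (x : D) : Fˣ := E.exp (Multiplicative.ofAdd x)

/-- The kernel of the exponential map, as a subset of `D`. -/
def ker (E : PartialEField F D) : Set D := {x | E.e x = 1}

/-- `Δ_F(x) = td(x, exp x / ker F) - ldim_ℚ(x / ker F)`. -/
def predim (E : PartialEField F D) {n : ℕ} (x : Fin n → D) : ℤ :=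
  (td (Set.range (fun i => E.incl (x i)) ∪ Set.range (fun i => (E.e (x i) : F)))
      (E.incl '' E.ker) : ℤ)
    - (ldim (Set.range x) E.ker : ℤ)

/-- The strong kernel property: `Δ_F(x) ≥ 0` for all finite tuples `x` on which `exp` is
defined. -/
def HasStrongKernel (E : PartialEField F D) : Prop :=
  ∀ (n : ℕ) (x : Fin n → D), 0 ≤ E.predim x

end PartialEField

/-! ### Zariski topology and dimension -/

/-- The points of the affine space with coordinates indexed by `σ`. -/
def AffinePoint (σ K : Type*) : Type _ := σ → K

/-- The Zariski topology: the closed sets are the zero loci of ideals of polynomials. -/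
abbrev zariski (σ K : Type*) [Field K] : TopologicalSpace (σ → K) :=
  TopologicalSpace.ofClosed
    (Set.range fun I : Ideal (MvPolynomial σ K) => zeroLocus K I)
    ⟨⊤, zeroLocus_top⟩
    (by
      intro A hA
      refine ⟨sSup {I | zeroLocus K I ∈ A}, Set.Subset.antisymm ?_ ?_⟩
      · intro x hx Z hZ
        obtain ⟨I, rfl⟩ := hA hZ
        exact fun p hp => hx p (le_sSup (a := I) hZ hp)
      · intro x hx
        have key : sSup {I | zeroLocus K I ∈ A} ≤ vanishingIdeal K {x} := by
          refine sSup_le ?_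
          intro I hI p hp
          exact (mem_vanishingIdeal_singleton_iff x p).2 (hx _ hI p hp)
        exact fun p hp => (mem_vanishingIdeal_singleton_iff x p).1 (key hp))
    (by
      rintro _ ⟨I, rfl⟩ _ ⟨J, rfl⟩
      refine ⟨I * J, Set.Subset.antisymm ?_ ?_⟩
      · intro x hx
        by_cases h : x ∈ zeroLocus K I
        · exact Or.inl h
        · refine Or.inr fun q hq => ?_
          rw [mem_zeroLocus_iff] at h
          push Not at h
          obtain ⟨p, hp, hpx⟩ := h
          have := hx (p * q) (Ideal.mul_mem_mul hp hq)
          rw [map_mul] at this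
          exact (mul_eq_zero.1 this).resolve_left hpx
      · exact Set.union_subset
          (zeroLocus_anti_mono (K := K) (I := I * J) (J := I) Ideal.mul_le_left)
          (zeroLocus_anti_mono (K := K) (I := I * J) (J := J) Ideal.mul_le_right))

instance (σ K : Type*) [Field K] : TopologicalSpace (AffinePoint σ K) := zariski σ K

/-- The dimension of a (constructible) set of points of affine space over an algebraically closed
field: the transcendence degree of the coordinate ring of its Zariski closure. For an irreducible
set this is the transcendence degree of the function field, in general it is the maximum over the
irreducible components. (The empty set gets dimension `0`.) -/
def AffinePoint.dim {σ K : Type*} [Field K] (S : Set (AffinePoint σ K)) : ℕ :=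
  Cardinal.toNat (Algebra.trdeg K (MvPolynomial σ K ⧸ vanishingIdeal K (S : Set (σ → K))))

/-- The points of the torus `𝔾_m^n` over `K`. -/
def Torus (n : ℕ) (K : Type*) [Field K] : Type _ := Fin n → Kˣ

instance (n : ℕ) (K : Type*) [Field K] : CommGroup (Torus n K) :=
  inferInstanceAs (CommGroup (Fin n → Kˣ))

/-- The points of `G^n = 𝔾_a^n × 𝔾_m^n` over `K`. -/
structure GPoint (n : ℕ) (K : Type*) [Field K] where
  add : Fin n → K
  mul : Torus n K

section Varieties

variable {n : ℕ} {K : Type*} [Field K]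

/-- The coordinates of a point of the torus. -/
def Torus.coords (b : Torus n K) : AffinePoint (Fin n) K := fun i => ((b i : Kˣ) : K)

/-- The coordinates of a point of `G^n`. -/
def GPoint.coords (v : GPoint n K) : AffinePoint (Fin n ⊕ Fin n) K :=
  Sum.elim v.add v.mul.coords

/-- The Zariski topology of the torus. -/
instance : TopologicalSpace (Torus n K) := .induced Torus.coords inferInstance

/-- The Zariski topology of `G^n`. -/
instance : TopologicalSpace (GPoint n K) := .induced GPoint.coords inferInstance

/-- Dimension of a subset of the torus. -/
def Torus.dim (S : Set (Torus n K)) : ℕ := AffinePoint.dim (Torus.coords '' S)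

/-- Dimension of a subset of `G^n`. -/
def GPoint.dim (S : Set (GPoint n K)) : ℕ := AffinePoint.dim (GPoint.coords '' S)

/-- `W` is an irreducible component of `V`: a maximal irreducible subset of `V`. -/
def IsIrredComponent {X : Type*} [TopologicalSpace X] (W V : Set X) : Prop :=
  Maximal (fun Z : Set X => IsIrreducible Z ∧ Z ⊆ V) W

/-! ### Generic fibres -/

/-- For irreducible `V ⊆ G^n`: the union of the fibres of generic dimension of the projection
`V → 𝔾_m^n`. -/
def irredGenericFibres (V : Set (GPoint n K)) : Set (GPoint n K) :=
  {v | v ∈ V ∧ (GPoint.dim {w | w ∈ V ∧ w.mul = v.mul} : ℤ)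
    = (GPoint.dim V : ℤ) - (Torus.dim (GPoint.mul '' V) : ℤ)}

/-- `V^gf`: the union of the `W^gf` over the irreducible components `W` of `V`. -/
def genericFibres (V : Set (GPoint n K)) : Set (GPoint n K) :=
  {v | ∃ W, IsIrredComponent W V ∧ v ∈ irredGenericFibres W}

/-! ### Atypical intersections -/

/-- `X` is an atypical component of `W ∩ H`: a connected component of `W ∩ H` with
`dim X > dim W + dim H - n`. -/
def IsAtypicalComponent (W : Set (Torus n K)) (H : Subgroup (Torus n K)) (X : Set (Torus n K)) :
    Prop :=
  (∃ b ∈ W ∩ (H : Set (Torus n K)), X = connectedComponentIn (W ∩ (H : Set (Torus n K))) b) ∧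
    (Torus.dim X : ℤ) > (Torus.dim W : ℤ) + (Torus.dim (H : Set (Torus n K)) : ℤ) - (n : ℤ)

/-- `W^atyp`, for `W` an irreducible subvariety of the torus: the union of all atypical components
of `W ∩ H`, for all algebraic (that is, Zariski closed) subgroups `H` of the torus. -/
def atyp (W : Set (Torus n K)) : Set (Torus n K) :=
  {b | ∃ H : Subgroup (Torus n K), IsClosed (H : Set (Torus n K)) ∧
    ∃ X, IsAtypicalComponent W H X ∧ b ∈ X}

/-- `pr(V)^atyp`: for irreducible `V` this is `W^atyp` for the irreducible subvariety `W` of the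
torus that is the Zariski closure of `pr(V)`; for reducible `V` it is the union over the
irreducible components of `V`. -/
def prAtyp (V : Set (GPoint n K)) : Set (Torus n K) :=
  {b | ∃ W, IsIrredComponent W V ∧ b ∈ atyp (closure (GPoint.mul '' W))}

/-- The fibre `V_p ⊆ G^n` at `p ∈ 𝔸^m` of the subvariety of `G^n × 𝔸^m` that is cut out by the
ideal `I` of polynomials over `ℚ`. -/
def familyFibre [CharZero K] {m : ℕ} (I : Ideal (MvPolynomial ((Fin n ⊕ Fin n) ⊕ Fin m) ℚ))
    (p : Fin m → K) : Set (GPoint n K) :=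
  {v | Sum.elim v.coords p ∈ zeroLocus K I}

end Varieties

/-! ### The Strong Kernel scheme -/

namespace PartialEField

variable {F D : Type*} [Field F] [CharZero F] [AddCommGroup D] [Module ℚ D]

/-- The tuple `exp x`, as a point of the torus over the algebraic closure of `F`. -/
def expPoint (E : PartialEField F D) {n : ℕ} (x : Fin n → D) : Torus n (AlgebraicClosure F) :=
  fun i => Units.map (algebraMap F (AlgebraicClosure F)).toMonoidHom (E.e (x i))

/-- The point `(x, exp x)` of `G^n` over the algebraic closure of `F`. -/
def graphPoint (E : PartialEField F D) {n : ℕ} (x : Fin n → D) :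
    GPoint n (AlgebraicClosure F) where
  add i := algebraMap F (AlgebraicClosure F) (E.incl (x i))
  mul := E.expPoint x

/-- The fibre `V_k` of a family at a tuple `k` from `D`, as a variety over the algebraic closure
of `F`. -/
def fibreAt (E : PartialEField F D) {n m : ℕ}
    (I : Ideal (MvPolynomial ((Fin n ⊕ Fin n) ⊕ Fin m) ℚ)) (k : Fin m → D) :
    Set (GPoint n (AlgebraicClosure F)) :=
  familyFibre I fun j => algebraMap F (AlgebraicClosure F) (E.incl (k j))

/-- The Strong Kernel scheme: one axiom for each family of subvarieties of `G^n`, parametrized by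
`𝔸^m` and defined over `ℚ`. -/
def StrongKernelScheme (E : PartialEField F D) : Prop :=
  ∀ (n m : ℕ) (I : Ideal (MvPolynomial ((Fin n ⊕ Fin n) ⊕ Fin m) ℚ)),
    ∀ k : Fin m → D, (∀ j, k j ∈ E.ker) → ∀ x : Fin n → D,
      n ≤ GPoint.dim (E.fibreAt I k) ∨
      E.graphPoint x ∉ genericFibres (E.fibreAt I k) ∨
      E.expPoint x ∈ prAtyp (E.fibreAt I k)

end PartialEField

end EField

end

/-! Write v = (x, e^x), and let K be the algebraic closure of F.

Strong kernel implies the scheme. Let v be in the generic fibres of a component W of V, with dim V <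
n. Choose a subtuple indexed by t that is a ℚ-basis of x modulo the span of the kernel. Every
e^{x_j} is, up to a positive power, a monomial in the e^{x_i} with i in t, so e^x lies in a closed
subgroup H with dim H ≤ |t|. Let k be the algebraic closure in K of the field generated by the
kernel. Then W is defined over k, and the locus of e^x over k is irreducible and contained in both H
and the closure of pr(W). The connected component X of the intersection at e^x therefore has dim X ≥
td(e^x/k). The fibre of W at e^x has dimension at least td(v/k(e^x)), and it equals dim W - dim
pr(W) by genericity. Since td(v/k) ≥ |t| by the strong kernel, dim X ≥ |t| - dim W + dim pr(W) > dim
pr(W) + dim H - n, so X is atypical. This count is `mem_prAtyp_of_mem_genericFibres`.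

The scheme implies strong kernel. If the predimension of x is negative, it is still negative on a
subtuple that is linearly independent modulo the kernel. The locus V of v over the kernel field is a
fibre of a family over ℚ (`exists_familyFibre_eq_locus`), has dimension below the length of the
subtuple, and has v in its generic fibres (`mem_genericFibres_locus`). The coordinates of e^x are
multiplicatively independent, so every algebraic subgroup through e^x is the whole torus and e^x
lies on no atypical component (`notMem_atyp_of_independent`). This contradicts the axiom for V.

Both directions compare dimensions of K-points with transcendence degrees over a subfield k. K may
be too small over k to contain generic points of all k-varieties, so the comparison runs through
ideals: `extendIdeal` extends an ideal from k to K, and for k algebraically closed `vanishing_locus`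
identifies it with the vanishing ideal of the K-points. -/

namespace EField

/-! ### Extension of scalars for polynomial ideals. -/

section ExtendIdeal

variable {k K σ τ : Type*} [Field k] [Field K] [Algebra k K]

/-- The map on polynomials that applies a `k`-linear functional `l : K → k` to the coefficients. -/
noncomputable def coeffMap (l : K →ₗ[k] k) (f : MvPolynomial σ K) : MvPolynomial σ k :=
  ∑ m ∈ f.support, monomial m (l (coeff m f))

theorem coeff_coeffMap (l : K →ₗ[k] k) (f : MvPolynomial σ K) (m : σ →₀ ℕ) :
    coeff m (coeffMap l f) = l (coeff m f) := by
  classical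
  rw [coeffMap, coeff_sum]
  simp only [coeff_monomial]
  rw [Finset.sum_ite_eq']
  split_ifs with h
  · rfl
  · rw [notMem_support_iff.1 h, map_zero]

theorem coeffMap_zero (l : K →ₗ[k] k) : coeffMap l (0 : MvPolynomial σ K) = 0 := by
  ext m; simp [coeff_coeffMap]

theorem coeffMap_add (l : K →ₗ[k] k) (f g : MvPolynomial σ K) :
    coeffMap l (f + g) = coeffMap l f + coeffMap l g := by
  ext m; simp [coeff_coeffMap]

theorem coeffMap_map_mul (l : K →ₗ[k] k) (g : MvPolynomial σ k) (f : MvPolynomial σ K) :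
    coeffMap l (map (algebraMap k K) g * f) = g * coeffMap l f := by
  classical
  ext m
  simp only [coeff_coeffMap, coeff_mul, coeff_map, map_sum]
  refine Finset.sum_congr rfl fun x _ => ?_
  rw [← Algebra.smul_def, map_smul, smul_eq_mul]

theorem coeffMap_map (l : K →ₗ[k] k) (g : MvPolynomial σ k) :
    coeffMap l (map (algebraMap k K) g) = g * C (l 1) := by
  ext m
  rw [coeff_coeffMap, coeff_map, mul_comm, coeff_C_mul, Algebra.algebraMap_eq_smul_one, map_smul,
    smul_eq_mul, mul_comm]

theorem coeffMap_C_mul (l : K →ₗ[k] k) (c : K) (f : MvPolynomial σ K) :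
    coeffMap l (C c * f) = coeffMap (l ∘ₗ LinearMap.mulLeft k c) f := by
  ext m; simp [coeff_coeffMap, coeff_C_mul]

theorem coeffMap_X_mul (l : K →ₗ[k] k) (i : σ) (f : MvPolynomial σ K) :
    coeffMap l (X i * f) = X i * coeffMap l f := by
  simpa using coeffMap_map_mul l (X i) f

/-- At k-rational points a functional on coefficients commutes with evaluation. This lets the
Nullstellensatz over k control polynomials over K. -/
theorem aeval_coeffMap (l : K →ₗ[k] k) (f : MvPolynomial σ K) (z : σ → k) :
    aeval z (coeffMap l f) = l (aeval (fun i => algebraMap k K (z i)) f) := by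
  rw [coeffMap, map_sum]
  conv_rhs => rw [f.as_sum, map_sum, map_sum]
  refine Finset.sum_congr rfl fun m _ => ?_
  rw [aeval_monomial, aeval_monomial, Finsupp.prod, Finsupp.prod]
  simp only [← map_pow, ← map_prod, Algebra.algebraMap_self, RingHom.id_apply]
  rw [mul_comm (coeff m f), ← Algebra.smul_def, map_smul, smul_eq_mul, mul_comm]

theorem coeffMap_monomial (l : K →ₗ[k] k) (m : σ →₀ ℕ) (a : K) :
    coeffMap l (monomial m a) = monomial m (l a) := by
  classical
  ext m'
  rw [coeff_coeffMap, coeff_monomial, coeff_monomial]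
  split_ifs <;> simp

theorem coeffMap_rename (l : K →ₗ[k] k) (e : σ → τ) (f : MvPolynomial σ K) :
    coeffMap l (rename e f) = rename e (coeffMap l f) := by
  induction f using MvPolynomial.induction_on' with
  | monomial m a =>
    rw [rename_monomial, coeffMap_monomial, coeffMap_monomial, rename_monomial]
  | add p q hp hq => simp only [map_add, coeffMap_add, hp, hq]

/-- The extension to `K[T]` of an ideal of `k[T]`. -/
noncomputable def extendIdeal (K : Type*) [Field K] [Algebra k K] (P : Ideal (MvPolynomial σ k)) :
    Ideal (MvPolynomial σ K) where
  -- In terms of a k-basis of K, f is a combination of polynomials over k; the condition says that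
  -- all of these lie in P, so this is the ideal generated by P.
  carrier := {f | ∀ l : K →ₗ[k] k, coeffMap l f ∈ P}
  zero_mem' l := by rw [coeffMap_zero]; exact P.zero_mem
  add_mem' hf hg l := by rw [coeffMap_add]; exact P.add_mem (hf l) (hg l)
  smul_mem' g := by
    intro f hf
    rw [smul_eq_mul]
    induction g using MvPolynomial.induction_on generalizing f with
    | C c => intro l; rw [coeffMap_C_mul]; exact hf _
    | add p q hp hq => intro l; rw [add_mul, coeffMap_add]; exact P.add_mem (hp hf l) (hq hf l)
    | mul_X p i hp =>
      rw [mul_assoc]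
      refine hp fun l => ?_
      rw [coeffMap_X_mul]
      exact P.mul_mem_left _ (hf l)

theorem mem_extendIdeal {P : Ideal (MvPolynomial σ k)} {f : MvPolynomial σ K} :
    f ∈ extendIdeal K P ↔ ∀ l : K →ₗ[k] k, coeffMap l f ∈ P := Iff.rfl

theorem exists_functional {a : K} (ha : a ≠ 0) : ∃ l : K →ₗ[k] k, l a ≠ 0 := by
  by_contra! h
  exact ha ((Module.forall_dual_apply_eq_zero_iff k a).1 h)

theorem map_mem_extendIdeal {P : Ideal (MvPolynomial σ k)} {g : MvPolynomial σ k} :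
    map (algebraMap k K) g ∈ extendIdeal K P ↔ g ∈ P := by
  constructor
  · intro h
    obtain ⟨l, hl⟩ := exists_functional (k := k) (one_ne_zero (α := K))
    have h1 := P.mul_mem_right (C (l 1)⁻¹) (h l)
    rwa [coeffMap_map, mul_assoc, ← C_mul, mul_inv_cancel₀ hl, C_1, mul_one] at h1
  · intro h l
    rw [coeffMap_map]
    exact P.mul_mem_right _ h

theorem mem_extendIdeal_of_map_mul_mem {P : Ideal (MvPolynomial σ k)} [P.IsPrime]
    {g : MvPolynomial σ k} (hg : g ∉ P) {f : MvPolynomial σ K}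
    (h : map (algebraMap k K) g * f ∈ extendIdeal K P) : f ∈ extendIdeal K P := by
  intro l
  have := h l
  rw [coeffMap_map_mul] at this
  exact (Ideal.IsPrime.mem_or_mem ‹_› this).resolve_left hg

theorem exists_zero_of_notMem [Finite σ] [IsAlgClosed k] {P : Ideal (MvPolynomial σ k)}
    [P.IsPrime] {g : MvPolynomial σ k} (hg : g ∉ P) :
    ∃ z : σ → k, z ∈ zeroLocus k P ∧ aeval z g ≠ 0 := by
  by_contra! h
  refine hg ?_
  rw [← IsPrime.vanishingIdeal_zeroLocus (K := k) P]
  exact h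

theorem isPrime_extendIdeal [Finite σ] [IsAlgClosed k] (P : Ideal (MvPolynomial σ k))
    [hP : P.IsPrime] : (extendIdeal K P).IsPrime := by
  refine Ideal.isPrime_iff.2 ⟨fun h => ?_, fun {f g} hfg => ?_⟩
  · refine hP.ne_top ((Ideal.eq_top_iff_one _).2 ?_)
    rw [← map_mem_extendIdeal (K := K), h]
    trivial
  · by_contra! hn
    simp only [mem_extendIdeal, not_forall] at hn
    obtain ⟨⟨l, hl⟩, ⟨m, hm⟩⟩ := hn
    -- Some k-rational zero of P makes both specialized polynomials nonzero. Then f and g are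
    -- nonzero there, so f * g is too, and a functional detects this value.
    obtain ⟨z, hz, hne⟩ := exists_zero_of_notMem fun h => (hP.mem_or_mem h).elim hl hm
    rw [map_mul, aeval_coeffMap, aeval_coeffMap] at hne
    obtain ⟨r, hr⟩ := exists_functional (k := k)
      (a := aeval (fun i => algebraMap k K (z i)) (f * g)) (by
        rw [map_mul]
        refine mul_ne_zero ?_ ?_ <;> intro h0 <;> simp [h0] at hne)
    rw [← aeval_coeffMap] at hr
    exact hr (hz _ (hfg r))

/-- Over an algebraically closed field, a polynomial over `K` that vanishes at the zeros of `P`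
outside the zero locus of `h ∉ P` lies in the extension of `P`. -/
theorem mem_extendIdeal_of_forall_zero [Finite σ] [IsAlgClosed k] {P : Ideal (MvPolynomial σ k)}
    [hP : P.IsPrime] {h : MvPolynomial σ k} (hh : h ∉ P) {f : MvPolynomial σ K}
    (hf : ∀ q ∈ zeroLocus K P, aeval q h ≠ 0 → aeval q f = 0) : f ∈ extendIdeal K P := by
  intro l
  by_contra hl
  obtain ⟨z, hz, hne⟩ := exists_zero_of_notMem fun h => (hP.mem_or_mem h).elim hh hl
  rw [map_mul, aeval_coeffMap] at hne
  refine right_ne_zero_of_mul hne ?_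
  rw [hf, map_zero]
  · intro g hg
    exact (aeval_algebraMap_apply K z g).trans (by rw [hz g hg, map_zero])
  · refine (aeval_algebraMap_apply K z h).trans_ne ?_
    simpa using left_ne_zero_of_mul hne

/-- Expanding the coefficients of f in a basis of K over k uses only finitely many basis vectors,
uniformly in the point q. -/
theorem aeval_eq_sum_coord {ι : Type*} (b : Module.Basis ι k K) (f : MvPolynomial σ K) :
    ∃ s : Finset ι, ∀ q : σ → K, aeval q f = ∑ i ∈ s, b i * aeval q (coeffMap (b.coord i) f) := by
  classical
  refine ⟨f.support.biUnion fun m => (b.repr (coeff m f)).support, fun q => ?_⟩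
  simp only [coeffMap, map_sum, Finset.mul_sum]
  rw [Finset.sum_comm]
  conv_lhs => rw [f.as_sum, map_sum]
  refine Finset.sum_congr rfl fun m hm => ?_
  simp only [aeval_monomial, ← mul_assoc]
  rw [← Finset.sum_mul]
  congr 1
  have h := b.linearCombination_repr (coeff m f)
  rw [Finsupp.linearCombination_apply, Finsupp.sum_of_support_subset (s :=
    f.support.biUnion fun m => (b.repr (coeff m f)).support)] at h
  · rw [Algebra.algebraMap_self, RingHom.id_apply]
    conv_lhs => rw [← h]
    refine Finset.sum_congr rfl fun i _ => ?_
    rw [Algebra.smul_def, mul_comm, Module.Basis.coord_apply]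
  · exact Finset.subset_biUnion_of_mem (fun m => (b.repr (coeff m f)).support) hm
  · simp

theorem aeval_eq_zero_of_mem_extendIdeal {P : Ideal (MvPolynomial σ k)} {f : MvPolynomial σ K}
    (hf : f ∈ extendIdeal K P) {q : σ → K} (hq : q ∈ zeroLocus K P) : aeval q f = 0 := by
  obtain ⟨s, hs⟩ := aeval_eq_sum_coord (Module.Basis.ofVectorSpace k K) f
  rw [hs]
  exact Finset.sum_eq_zero fun i _ => by rw [hq _ (hf _), mul_zero]

theorem eq_zero_of_coeffMap_eq_zero {f : MvPolynomial σ K}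
    (h : ∀ l : K →ₗ[k] k, coeffMap l f = 0) : f = 0 := by
  ext m
  by_contra hm
  obtain ⟨l, hl⟩ := exists_functional (k := k) hm
  rw [← coeff_coeffMap, h] at hl
  simp at hl

end ExtendIdeal

/-! ### Transcendence degree of a point. -/

section TranscendenceDegree

universe u
variable {k K : Type u} {σ : Type*} [Field k] [Field K] [Algebra k K]

/-- The transcendence degree over `k` of the field generated by the coordinates of a point. -/
noncomputable def tdeg (k : Type u) {K : Type u} [Field k] [Field K] [Algebra k K]
    (p : σ → K) : ℕ :=
  Cardinal.toNat (Algebra.trdeg k (IntermediateField.adjoin k (Set.range p)))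

/-- Points with the same ideal over k have the same algebraically independent sets of coordinates,
even when they live in different algebras. -/
theorem algebraicIndepOn_congr {A B : Type*} [CommRing A] [Algebra k A] [CommRing B] [Algebra k B]
    {p : σ → A} {q : σ → B} (h : ∀ f : MvPolynomial σ k, aeval p f = 0 ↔ aeval q f = 0)
    (s : Set σ) : AlgebraicIndepOn k p s ↔ AlgebraicIndepOn k q s := by
  rw [AlgebraicIndepOn, AlgebraicIndepOn, algebraicIndependent_iff, algebraicIndependent_iff]
  refine forall_congr' fun f => imp_congr_left ?_
  have := h (rename Subtype.val f)
  rwa [aeval_rename, aeval_rename] at this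

theorem isAlgebraic_adjoin_congr {A B : Type*} [CommRing A] [Algebra k A] [CommRing B] [Algebra k B]
    [Nontrivial B] {p : σ → A} {q : σ → B} (h : ∀ f : MvPolynomial σ k, aeval p f = 0 ↔ aeval q f = 0)
    {s : Set σ} (hs : AlgebraicIndepOn k p s) {j : σ}
    (hj : IsAlgebraic (Algebra.adjoin k (p '' s)) (p j)) :
    IsAlgebraic (Algebra.adjoin k (q '' s)) (q j) := by
  by_cases hjs : j ∈ s
  · exact isAlgebraic_algebraMap
      (⟨q j, Algebra.subset_adjoin ⟨j, hjs, rfl⟩⟩ : Algebra.adjoin k (q '' s))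
  · by_contra hn
    have h1 := (AlgebraicIndepOn.insert_iff hjs).2 ⟨(algebraicIndepOn_congr h s).1 hs, hn⟩
    exact ((AlgebraicIndepOn.insert_iff hjs).1 ((algebraicIndepOn_congr h _).2 h1)).2 hj

theorem isAlgebraic_adjoin_of_tower {A : Type*} [CommRing A] [Algebra k A] [Algebra K A]
    [IsScalarTower k K A] [IsDomain A] {s : Set A} {a : A}
    (h : IsAlgebraic (Algebra.adjoin k s) a) : IsAlgebraic (Algebra.adjoin K s) a := by
  have hle : Algebra.adjoin k s ≤ (Algebra.adjoin K s).restrictScalars k :=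
    Algebra.adjoin_le Algebra.subset_adjoin
  let f : Algebra.adjoin k s →+* Algebra.adjoin K s :=
    (Algebra.adjoin k s).val.toRingHom.codRestrict (Algebra.adjoin K s) fun x => hle x.2
  have hf : Function.Injective f := fun x y hxy =>
    Subtype.ext (congrArg (fun z : Algebra.adjoin K s => (z : A)) hxy)
  let _ : Algebra (Algebra.adjoin k s) (Algebra.adjoin K s) := f.toAlgebra
  have : IsScalarTower (Algebra.adjoin k s) (Algebra.adjoin K s) A :=
    .of_algebraMap_eq fun ⟨y, _⟩ => show y = y from rfl
  exact IsAlgebraic.extendScalars hf h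

theorem exists_algebraicIndepOn_card_eq_tdeg [Finite σ] (p : σ → K) :
    ∃ t : Finset σ, AlgebraicIndepOn k p (t : Set σ) ∧
      (∀ j, IsAlgebraic (Algebra.adjoin k (p '' t)) (p j)) ∧
      t.card = tdeg k p ∧
      Algebra.trdeg k (IntermediateField.adjoin k (Set.range p)) = t.card := by
  classical
  let L := IntermediateField.adjoin k (Set.range p)
  -- The coordinates are viewed inside the field L that they generate, where a transcendence basis
  -- can be extracted from them.
  let p' : σ → L := fun i => ⟨p i, IntermediateField.subset_adjoin k _ ⟨i, rfl⟩⟩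
  have hp' : IntermediateField.adjoin k (Set.range p') = ⊤ := by
    apply IntermediateField.lift_injective L
    rw [IntermediateField.lift_adjoin, IntermediateField.lift_top, ← Set.range_comp]
    rfl
  have halg : Algebra.IsAlgebraic (Algebra.adjoin k (Set.range p')) L := by
    refine ⟨fun x => IntermediateField.isAlgebraic_adjoin_iff.1 ?_⟩
    exact isAlgebraic_algebraMap
      (⟨x, by rw [hp']; trivial⟩ : IntermediateField.adjoin k (Set.range p'))
  obtain ⟨s, hs, hb⟩ := exists_isTranscendenceBasis_subset (R := k) (A := L) (Set.range p')
  have hsurj : Set.SurjOn p' Set.univ s := by rwa [Set.SurjOn, Set.image_univ]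
  obtain ⟨t, -, ht⟩ := hsurj.exists_bijOn_subset
  lift t to Finset σ using t.toFinite
  have himg : p' '' (t : Set σ) = s := ht.image_eq
  have hinj : Set.InjOn p' (t : Set σ) := ht.injOn
  have hind : AlgebraicIndepOn k p' (t : Set σ) := by
    rw [← himg] at hb
    exact (algebraicIndependent_image hinj).2 hb.1
  have hcard : Algebra.trdeg k L = t.card := by
    have h1 := Cardinal.mk_image_eq_of_injOn_lift p' _ hinj
    rw [himg, hb.cardinalMk_eq_trdeg] at h1
    rw [← Cardinal.lift_inj.{u, _}, h1]
    simp
  refine ⟨t, ?_, fun j => ?_, ?_, hcard⟩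
  · exact AlgebraicIndependent.map' (f := L.val) hind Subtype.val_injective
  · have h1 := hb.isAlgebraic.1 (p' j)
    rw [Subtype.range_coe, ← himg] at h1
    exact isAlgebraic_adjoin_congr (fun f => by
      rw [← map_eq_zero_iff L.val Subtype.val_injective, comp_aeval_apply]; rfl) hind h1
  · rw [tdeg, hcard, Cardinal.toNat_natCast]

theorem trdeg_adjoin_lt_aleph0 [Finite σ] (p : σ → K) :
    Algebra.trdeg k (IntermediateField.adjoin k (Set.range p)) < Cardinal.aleph0 := by
  obtain ⟨t, -, -, -, h⟩ := exists_algebraicIndepOn_card_eq_tdeg (k := k) p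
  rw [h]
  exact Cardinal.natCast_lt_aleph0

theorem AlgebraicIndepOn.card_le_tdeg [Finite σ] {p : σ → K} {t : Finset σ}
    (h : AlgebraicIndepOn k p (t : Set σ)) : t.card ≤ tdeg k p := by
  let L := IntermediateField.adjoin k (Set.range p)
  let p' : σ → L := fun i => ⟨p i, IntermediateField.subset_adjoin k _ ⟨i, rfl⟩⟩
  have h' : AlgebraicIndependent k (fun i : (t : Set σ) => p' i) :=
    AlgebraicIndependent.of_comp L.val h
  have := Cardinal.toNat_le_toNat h'.lift_cardinalMk_le_trdeg
    (Cardinal.lift_lt_aleph0.2 (trdeg_adjoin_lt_aleph0 p))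
  simpa [tdeg] using this

/-- Additivity in the tower k ⊆ k(b) ⊆ k(p). -/
theorem tdeg_eq_add [Finite σ] {τ : Type*} [Finite τ] (p : σ → K) (b : τ → K)
    (hb : Set.range b ⊆ Set.range p) :
    tdeg k p = tdeg k b + tdeg (IntermediateField.adjoin k (Set.range b)) p := by
  let k' := IntermediateField.adjoin k (Set.range b)
  let L := IntermediateField.adjoin k' (Set.range p)
  have hL : L.restrictScalars k = IntermediateField.adjoin k (Set.range p) := by
    rw [IntermediateField.adjoin_adjoin_left, Set.union_eq_self_of_subset_left hb]
  have h1 : Algebra.trdeg k L = Algebra.trdeg k (IntermediateField.adjoin k (Set.range p)) :=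
    (IntermediateField.equivOfEq hL).trdeg_eq
  have : FaithfulSMul k' L :=
    (faithfulSMul_iff_algebraMap_injective _ _).2 (algebraMap k' L).injective
  rw [tdeg, ← h1, ← _root_.trdeg_add_eq k k' (A := L),
    Cardinal.toNat_add (trdeg_adjoin_lt_aleph0 b) (trdeg_adjoin_lt_aleph0 p)]
  rfl

/-- Algebraic extensions of the base field do not change the transcendence degree. -/
theorem tdeg_le_of_isAlgebraic [Finite σ] {k' : Type u} [Field k'] [Algebra k k'] [Algebra k' K]
    [IsScalarTower k k' K] [Algebra.IsAlgebraic k k'] (p : σ → K) : tdeg k p ≤ tdeg k' p := by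
  obtain ⟨t, ht, -, hc, -⟩ := exists_algebraicIndepOn_card_eq_tdeg (k := k) p
  rw [← hc]
  exact AlgebraicIndepOn.card_le_tdeg (AlgebraicIndependent.extendScalars k' ht)

end TranscendenceDegree

/-! ### Dimension of a set of points versus transcendence degree of a point. -/

section Dimension

universe u
variable {k K : Type u} [Field k] [Field K] [Algebra k K]
variable {σ : Type}

theorem trdeg_quotient_lt_aleph0 [Finite σ] (J : Ideal (MvPolynomial σ K)) :
    Algebra.trdeg K (MvPolynomial σ K ⧸ J) < Cardinal.aleph0 :=
  trdeg_lt_aleph0_of_finiteType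

theorem AffinePoint.dim_mono [Finite σ] {S T : Set (AffinePoint σ K)}
    (h : vanishingIdeal K (T : Set (σ → K)) ≤ vanishingIdeal K (S : Set (σ → K))) :
    AffinePoint.dim S ≤ AffinePoint.dim T :=
  Cardinal.toNat_le_toNat
    (trdeg_le_of_surjective (Ideal.Quotient.factorₐ K h) (Ideal.Quotient.factor_surjective h))
    (trdeg_quotient_lt_aleph0 _)

/-- A set whose vanishing ideal lies in the extension of the ideal of `p` over `k` has dimension at
least the transcendence degree of `p` over `k`. -/
theorem tdeg_le_dim [Finite σ] {p : σ → K} {S : Set (AffinePoint σ K)}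
    (h : vanishingIdeal K (S : Set (σ → K)) ≤
      extendIdeal K (RingHom.ker (aeval (R := k) p))) : tdeg k p ≤ AffinePoint.dim S := by
  obtain ⟨t, ht, -, hc, -⟩ := exists_algebraicIndepOn_card_eq_tdeg (k := k) p
  have hi : AlgebraicIndependent K (fun i : t =>
      (Ideal.Quotient.mk (vanishingIdeal K (S : Set (σ → K))) (X (i : σ)))) := by
    rw [algebraicIndependent_iff]
    intro f hf
    have h1 : Ideal.Quotient.mkₐ K (vanishingIdeal K (S : Set (σ → K)))
        (rename (fun i : t => (i : σ)) f) = 0 := by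
      rw [← hf, ← aeval_X_left_apply (rename _ f), aeval_rename, comp_aeval_apply]
      rfl
    have h2 := h (Ideal.Quotient.eq_zero_iff_mem.1 h1)
    -- Each functional turns a relation over K among the coordinates in t into a relation over k
    -- satisfied by p, which must be trivial.
    refine eq_zero_of_coeffMap_eq_zero (k := k) fun l => ?_
    have h3 := h2 l
    rw [coeffMap_rename, RingHom.mem_ker, aeval_rename] at h3
    exact ht.eq_zero_of_aeval_eq_zero _ h3
  rw [← hc, AffinePoint.dim]
  have := Cardinal.toNat_le_toNat hi.lift_cardinalMk_le_trdeg
    (Cardinal.lift_lt_aleph0.2 (trdeg_quotient_lt_aleph0 _))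
  simpa using this

/-- An upper bound for the transcendence degree of an algebra that need not be a domain. -/
theorem trdeg_quotient_le (J : Ideal (MvPolynomial σ K)) (N : Submonoid (MvPolynomial σ K))
    (hN : ∀ f ∈ N, ∀ g, f * g ∈ J → g ∈ J) (t : Finset σ)
    (halg : ∀ Q : Ideal (MvPolynomial σ K), Q.IsPrime → J ≤ Q → (∀ f ∈ N, f ∉ Q) → ∀ j,
      IsAlgebraic (Algebra.adjoin K ((fun i => Ideal.Quotient.mk Q (X i)) '' (t : Set σ)))
        (Ideal.Quotient.mk Q (X j))) :
    Algebra.trdeg K (MvPolynomial σ K ⧸ J) ≤ t.card := by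
  -- The transcendence degree is a supremum over algebraically independent sets, so one such set s
  -- is bounded at a time.
  refine ciSup_le' fun ⟨s, hs⟩ => ?_
  choose z hz using fun a : s => Ideal.Quotient.mk_surjective (a : MvPolynomial σ K ⧸ J)
  have hz' (f : MvPolynomial s K) : aeval z f ∈ J → f = 0 := fun hf => by
    refine hs.eq_zero_of_aeval_eq_zero f ?_
    rw [← Ideal.Quotient.eq_zero_iff_mem, ← Ideal.Quotient.mkₐ_eq_mk K, comp_aeval_apply] at hf
    simpa [hz] using hf
  -- The prime Q avoids N and all nonzero polynomial expressions in the lifts of s. Modulo Q the set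
  -- s stays independent, now in a domain that is algebraic over the coordinates in t.
  obtain ⟨Q, hQ, hle, hd⟩ := Ideal.exists_le_prime_disjoint J
    (N ⊔ (nonZeroDivisors (MvPolynomial s K)).map (aeval (R := K) z)) (by
      rw [Set.disjoint_left]
      intro a ha ha'
      obtain ⟨f, hf, _, ⟨g, hg, rfl⟩, rfl⟩ := Submonoid.mem_sup.1 ha'
      exact nonZeroDivisors.ne_zero hg (hz' g (hN f hf _ ha)))
  rw [Set.disjoint_right] at hd
  have hind : AlgebraicIndependent K fun a : s => Ideal.Quotient.mk Q (z a) := by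
    rw [algebraicIndependent_iff]
    intro f hf
    by_contra hf0
    refine hd (Submonoid.mem_sup_right ⟨f, mem_nonZeroDivisors_of_ne_zero hf0, rfl⟩) ?_
    refine Ideal.Quotient.eq_zero_iff_mem.1 ?_
    rw [← hf, ← Ideal.Quotient.mkₐ_eq_mk K]
    exact comp_aeval_apply ..
  have halg' : Algebra.IsAlgebraic
      (Algebra.adjoin K ((fun i => Ideal.Quotient.mk Q (X i)) '' (t : Set σ)))
      (MvPolynomial σ K ⧸ Q) := by
    refine ⟨fun a => ?_⟩
    obtain ⟨f, rfl⟩ := Ideal.Quotient.mk_surjective a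
    induction f using MvPolynomial.induction_on with
    | C c => exact isAlgebraic_algebraMap (algebraMap K (Algebra.adjoin K _) c)
    | add f g hf hg => rw [map_add]; exact hf.add hg
    | mul_X f i hf =>
      rw [map_mul]
      exact hf.mul (halg Q hQ hle (fun f hf => hd (Submonoid.mem_sup_left hf)) i)
  have h1 := hind.lift_cardinalMk_le_trdeg
  have h2 := Algebra.IsAlgebraic.trdeg_le_cardinalMk K
    ((fun i => Ideal.Quotient.mk Q (X i)) '' (t : Set σ))
  rw [Cardinal.lift_id, Cardinal.lift_id] at h1
  refine h1.trans (h2.trans ?_)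
  have h3 := Cardinal.mk_image_le_lift (f := fun i => Ideal.Quotient.mk Q (X i)) (s := (t : Set σ))
  simpa using h3

/-- Here k need not be algebraically closed, so the extended ideal need not be prime. Elements
outside P are still nonzerodivisors modulo it, and a prime Q above it avoiding them contracts to P.
The coordinates modulo Q then satisfy the same relations over k as p, so a transcendence basis of p
also bounds the quotient by Q. -/
theorem dim_le_tdeg [Finite σ] {p : σ → K} {S : Set (AffinePoint σ K)}
    (h : ∀ q ∈ S, q ∈ zeroLocus K (RingHom.ker (aeval (R := k) p))) :
    AffinePoint.dim S ≤ tdeg k p := by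
  obtain ⟨t, ht, halg, hc, -⟩ := exists_algebraicIndepOn_card_eq_tdeg (k := k) p
  set P := RingHom.ker (aeval (R := k) p) with hP
  have hprime : P.IsPrime := RingHom.ker_isPrime _
  have hJ : extendIdeal K P ≤ vanishingIdeal K (S : Set (σ → K)) := fun f hf q hq =>
    aeval_eq_zero_of_mem_extendIdeal hf (h q hq)
  have h1 : Algebra.trdeg K (MvPolynomial σ K ⧸ extendIdeal K P) ≤ t.card := by
    refine trdeg_quotient_le _ (P.primeCompl.map (map (algebraMap k K))) ?_ t ?_
    · rintro _ ⟨f, hf, rfl⟩ g hfg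
      exact mem_extendIdeal_of_map_mul_mem hf hfg
    · intro Q hQ hle hN j
      refine isAlgebraic_adjoin_of_tower (k := k) (isAlgebraic_adjoin_congr (p := p) (fun f => ?_)
        ht (halg j))
      have h2 : aeval (fun i => Ideal.Quotient.mk Q (X i)) f =
          Ideal.Quotient.mk Q (map (algebraMap k K) f) := by
        induction f using MvPolynomial.induction_on with
        | C a => rw [aeval_C, map_C, IsScalarTower.algebraMap_apply k K]; rfl
        | add f g hf hg => simp only [map_add, hf, hg]
        | mul_X f i hf => rw [map_mul, hf, aeval_X, map_mul, map_mul, map_X]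
      rw [h2, Ideal.Quotient.eq_zero_iff_mem]
      refine ⟨fun h => hle (map_mem_extendIdeal.2 h), fun h => ?_⟩
      by_contra hn
      exact hN _ ⟨f, hn, rfl⟩ h
  rw [← hc]
  have h2 := (trdeg_le_of_surjective (Ideal.Quotient.factorₐ K hJ)
    (Ideal.Quotient.factor_surjective hJ)).trans h1
  simpa [AffinePoint.dim] using Cardinal.toNat_le_toNat h2 Cardinal.natCast_lt_aleph0

end Dimension

/-! ### Clearing denominators over a generated field. -/

section Denominators

variable {k L K : Type*} {σ : Type*} [Field k] [Field L] [Field K] [Algebra k L] [Algebra L K]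
  [Algebra k K] [IsScalarTower k L K]

/-- Clearing denominators: a polynomial over `k(X)` is, up to a nonzero constant, the
specialization of a polynomial over `k` with extra variables indexed by `X`. -/
theorem exists_clear_denominators (Y : Set L)
    (f : MvPolynomial σ (IntermediateField.adjoin k Y)) :
    ∃ d : MvPolynomial Y k, aeval (fun y : Y => algebraMap L K y) d ≠ 0 ∧
      ∃ g : MvPolynomial (σ ⊕ Y) k, ∀ q : σ → K,
        aeval (Sum.elim q fun y : Y => algebraMap L K y) g =
          aeval (fun y : Y => algebraMap L K y) d * aeval q f := by
  induction f using MvPolynomial.induction_on with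
  | C a =>
    obtain ⟨a, ha⟩ := a
    obtain ⟨r, hr, s, hs, rfl⟩ := IntermediateField.mem_adjoin_iff_div.1 ha
    rw [Algebra.adjoin_eq_range] at hr hs
    obtain ⟨r, rfl⟩ := hr
    obtain ⟨s, rfl⟩ := hs
    by_cases h0 : aeval (fun y : Y => algebraMap L K y) s = 0
    -- Division by zero: the constant is 0 by convention.
    · refine ⟨1, by simp, 0, fun q => ?_⟩
      have h1 : (aeval (fun y : Y => (y : L)) s : L) = 0 := by
        apply (algebraMap L K).injective
        rw [map_zero, ← h0]
        exact (aeval_algebraMap_apply K _ s).symm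
      simp only [map_zero, map_one, one_mul, aeval_C]
      have h2 : (⟨aeval (fun y : Y => (y : L)) r / aeval (fun y : Y => (y : L)) s, ha⟩ :
          IntermediateField.adjoin k Y) = 0 := Subtype.ext (by simp [h1])
      exact ((congrArg _ h2).trans (map_zero _)).symm
    · refine ⟨s, h0, rename Sum.inr r, fun q => ?_⟩
      rw [aeval_rename, Sum.elim_comp_inr, aeval_C]
      have h1 (r : MvPolynomial Y k) : aeval (fun y : Y => algebraMap L K y) r =
        algebraMap L K (aeval (fun y : Y => (y : L)) r) := aeval_algebraMap_apply K _ r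
      rw [h1] at h0
      rw [h1, h1]
      refine Eq.trans ?_ (congrArg _ (map_div₀ (algebraMap L K) _ _).symm)
      exact (mul_div_cancel₀ _ h0).symm
  | add f g hf hg =>
    obtain ⟨d, hd, f', hf⟩ := hf
    obtain ⟨e, he, g', hg⟩ := hg
    refine ⟨d * e, by rw [map_mul]; exact mul_ne_zero hd he,
      rename Sum.inr e * f' + rename Sum.inr d * g', fun q => ?_⟩
    simp only [map_add, map_mul, aeval_rename, Sum.elim_comp_inr, hf, hg]
    ring
  | mul_X f i hf =>
    obtain ⟨d, hd, f', hf⟩ := hf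
    refine ⟨d, hd, f' * X (Sum.inl i), fun q => ?_⟩
    simp only [map_mul, hf, aeval_X, Sum.elim_inl]
    ring

end Denominators

/-! ### Closure, irreducibility and loci in Zariski topologies. -/

section Zariski

variable {σ K : Type*} [Field K]

variable {Y : Type*} [TopologicalSpace Y] {c : Y → σ → K}

/-- `c` is a system of coordinates that defines the topology of `Y` as a Zariski topology. -/
def IsZariski (c : Y → σ → K) : Prop :=
  ∀ S : Set Y, IsClosed S ↔ ∃ I : Ideal (MvPolynomial σ K), S = {y | c y ∈ zeroLocus K I}

theorem isZariski_of_isInducing {c : Y → AffinePoint σ K} (hc : Topology.IsInducing c) :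
    IsZariski (K := K) (σ := σ) c := by
  have h (S : Set (AffinePoint σ K)) :
      IsClosed S ↔ ∃ I : Ideal (MvPolynomial σ K), zeroLocus K I = S := by
    rw [← isOpen_compl_iff]
    change Sᶜᶜ ∈ _ ↔ _
    rw [compl_compl]
    rfl
  intro S
  rw [hc.isClosed_iff]
  constructor
  · rintro ⟨_, ht, rfl⟩
    obtain ⟨I, rfl⟩ := (h _).1 ht
    exact ⟨I, rfl⟩
  · rintro ⟨I, rfl⟩
    exact ⟨zeroLocus K I, (h _).2 ⟨I, rfl⟩, rfl⟩

theorem IsZariski.isClosed_setOf_aeval_eq_zero (hc : IsZariski c) (f : MvPolynomial σ K) :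
    IsClosed {y | aeval (c y) f = 0} := by
  refine (hc _).2 ⟨Ideal.span {f}, ?_⟩
  ext y
  rw [zeroLocus_span]
  simp only [Set.mem_singleton_iff, forall_eq]
  rfl

/-- The ideal of polynomials that vanish on a set of points with coordinate map `c`. -/
noncomputable def vanishing (c : Y → σ → K) (S : Set Y) : Ideal (MvPolynomial σ K) :=
  vanishingIdeal K (c '' S)

omit [TopologicalSpace Y] in
theorem mem_vanishing {S : Set Y} {f : MvPolynomial σ K} :
    f ∈ vanishing c S ↔ ∀ y ∈ S, aeval (c y) f = 0 := by
  rw [vanishing, mem_vanishingIdeal_iff, Set.forall_mem_image]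

theorem mem_closure_iff_vanishing (hc : IsZariski c) {S : Set Y} {y : Y} :
    y ∈ closure S ↔ ∀ f ∈ vanishing c S, aeval (c y) f = 0 := by
  constructor
  · intro hy f hf
    exact closure_minimal (mem_vanishing.1 hf) (hc.isClosed_setOf_aeval_eq_zero f) hy
  · intro h
    obtain ⟨I, hI⟩ := (hc _).1 (isClosed_closure (s := S))
    rw [hI]
    refine fun f hf => h f (mem_vanishing.2 fun z hz => ?_)
    have := subset_closure hz
    rw [hI] at this
    exact this f hf

theorem isIrreducible_iff_isPrime_vanishing (hc : IsZariski c) {S : Set Y} :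
    IsIrreducible S ↔ (vanishing c S).IsPrime := by
  constructor
  · rintro ⟨⟨y, hy⟩, hS⟩
    rw [isPreirreducible_iff_isClosed_union_isClosed] at hS
    refine Ideal.isPrime_iff.2 ⟨fun h => ?_, fun {f g} hfg => ?_⟩
    · have h1 : (1 : MvPolynomial σ K) ∈ vanishing c S := by rw [h]; trivial
      simpa using mem_vanishing.1 h1 y hy
    · have := hS _ _ (hc.isClosed_setOf_aeval_eq_zero f) (hc.isClosed_setOf_aeval_eq_zero g)
        (fun z hz => by simpa using mem_vanishing.1 hfg z hz)
      exact this.imp mem_vanishing.2 mem_vanishing.2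
  · intro h
    refine ⟨?_, ?_⟩
    · rw [Set.nonempty_iff_ne_empty]
      rintro rfl
      refine h.ne_top ((Ideal.eq_top_iff_one _).2 (mem_vanishing.2 fun y hy => hy.elim))
    · rw [isPreirreducible_iff_isClosed_union_isClosed]
      intro Z₁ Z₂ h₁ h₂ hS
      obtain ⟨I₁, rfl⟩ := (hc _).1 h₁
      obtain ⟨I₂, rfl⟩ := (hc _).1 h₂
      by_contra! hn
      rw [Set.not_subset, Set.not_subset] at hn
      obtain ⟨⟨y, hy, hy'⟩, z, hz, hz'⟩ := hn
      obtain ⟨f, hf, hfy⟩ : ∃ f ∈ I₁, aeval (c y) f ≠ 0 := by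
        by_contra! h
        exact hy' h
      obtain ⟨g, hg, hgz⟩ : ∃ g ∈ I₂, aeval (c z) g ≠ 0 := by
        by_contra! h
        exact hz' h
      have hfg : f * g ∈ vanishing c S := mem_vanishing.2 fun w hw => by
        rw [map_mul]
        rcases hS hw with hw | hw
        · rw [hw f hf, zero_mul]
        · rw [hw g hg, mul_zero]
      rcases h.mem_or_mem hfg with h | h
      · exact hfy (mem_vanishing.1 h y hy)
      · exact hgz (mem_vanishing.1 h z hz)

variable {k : Type*} [Field k] [Algebra k K]

/-- The points, with coordinate map `c`, at which the polynomials in `P` vanish. -/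
def locus (c : Y → σ → K) (P : Ideal (MvPolynomial σ k)) : Set Y :=
  {y | c y ∈ zeroLocus K P}

/-- The ideal over `k` of a point. -/
noncomputable abbrev pointIdeal (k : Type*) [Field k] [Algebra k K] (p : σ → K) :
    Ideal (MvPolynomial σ k) := RingHom.ker (aeval (R := k) p)

-- The coordinate map need not be onto: for the torus and G^n it misses only points where h, the
-- product of the multiplicative coordinates, vanishes. As h is not in the prime P, the
-- Nullstellensatz over k still works with the zeros of P off h = 0.
omit [TopologicalSpace Y] in
theorem vanishing_locus [Finite σ] [IsAlgClosed k] {P : Ideal (MvPolynomial σ k)} [P.IsPrime]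
    {h : MvPolynomial σ k} (hh : h ∉ P)
    (hrange : ∀ q : σ → K, aeval q h ≠ 0 → q ∈ Set.range c) :
    vanishing c (locus c P) = extendIdeal K P := by
  apply le_antisymm
  · intro f hf
    refine mem_extendIdeal_of_forall_zero hh fun q hq hne => ?_
    obtain ⟨y, rfl⟩ := hrange q hne
    exact mem_vanishing.1 hf y hq
  · exact fun f hf => mem_vanishing.2 fun y hy => aeval_eq_zero_of_mem_extendIdeal hf hy

theorem isIrreducible_locus (hc : IsZariski c) [Finite σ] [IsAlgClosed k]
    {P : Ideal (MvPolynomial σ k)} [P.IsPrime] {h : MvPolynomial σ k} (hh : h ∉ P)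
    (hrange : ∀ q : σ → K, aeval q h ≠ 0 → q ∈ Set.range c) : IsIrreducible (locus c P) := by
  rw [isIrreducible_iff_isPrime_vanishing hc, vanishing_locus hh hrange]
  exact isPrime_extendIdeal P

end Zariski

/-! ### Coordinates on the torus and on G^n. -/

section Coordinates

variable {n : ℕ} {K : Type*} [Field K]

/-- The coordinates of a point of the torus, as a vector. -/
def Torus.vec (b : Torus n K) : Fin n → K := b.coords

/-- The coordinates of a point of `G^n`, as a vector. -/
def GPoint.vec (v : GPoint n K) : Fin n ⊕ Fin n → K := v.coords

theorem Torus.isZariski_vec : IsZariski (Torus.vec : Torus n K → _) :=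
  isZariski_of_isInducing (c := Torus.coords) ⟨rfl⟩

theorem GPoint.isZariski_vec : IsZariski (GPoint.vec : GPoint n K → _) :=
  isZariski_of_isInducing (c := GPoint.coords) ⟨rfl⟩

theorem Torus.vec_ne_zero (b : Torus n K) (i : Fin n) : b.vec i ≠ 0 := (b i).ne_zero

theorem GPoint.vec_inr (v : GPoint n K) (i : Fin n) : v.vec (Sum.inr i) = v.mul.vec i := rfl

theorem GPoint.vec_comp_inr (v : GPoint n K) : v.vec ∘ Sum.inr = v.mul.vec := rfl

theorem Torus.vec_injective : Function.Injective (Torus.vec : Torus n K → _) :=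
  fun _ _ h => funext fun i => Units.ext (congrFun h i)

variable (k : Type*) [Field k] [Algebra k K]

theorem Torus.mem_range_vec {q : Fin n → K}
    (h : aeval q (∏ i, X i : MvPolynomial (Fin n) k) ≠ 0) :
    q ∈ Set.range (Torus.vec : Torus n K → _) := by
  rw [map_prod, Finset.prod_ne_zero_iff] at h
  simp only [aeval_X] at h
  exact ⟨fun i => Units.mk0 (q i) (h i (Finset.mem_univ i)), rfl⟩

theorem Torus.aeval_prod_X_ne_zero (b : Torus n K) :
    aeval b.vec (∏ i, X i : MvPolynomial (Fin n) k) ≠ 0 := by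
  rw [map_prod, Finset.prod_ne_zero_iff]
  intro i _
  rw [aeval_X]
  exact b.vec_ne_zero i

theorem GPoint.mem_range_vec {q : Fin n ⊕ Fin n → K}
    (h : aeval q (∏ i, X (Sum.inr i) : MvPolynomial (Fin n ⊕ Fin n) k) ≠ 0) :
    q ∈ Set.range (GPoint.vec : GPoint n K → _) := by
  rw [map_prod, Finset.prod_ne_zero_iff] at h
  simp only [aeval_X] at h
  refine ⟨⟨fun i => q (Sum.inl i), fun i => Units.mk0 (q (Sum.inr i)) (h i (Finset.mem_univ i))⟩,
    funext ?_⟩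
  rintro (i | i) <;> rfl

theorem GPoint.aeval_prod_X_ne_zero (v : GPoint n K) :
    aeval v.vec (∏ i, X (Sum.inr i) : MvPolynomial (Fin n ⊕ Fin n) k) ≠ 0 := by
  rw [map_prod, Finset.prod_ne_zero_iff]
  intro i _
  rw [aeval_X, vec_inr]
  exact v.mul.vec_ne_zero i

variable {k}

theorem mem_vanishing_image_mul (S : Set (GPoint n K)) (f : MvPolynomial (Fin n) K) :
    f ∈ vanishing Torus.vec (GPoint.mul '' S) ↔
      rename Sum.inr f ∈ vanishing GPoint.vec S := by
  simp only [mem_vanishing, Set.forall_mem_image, aeval_rename, GPoint.vec_comp_inr]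

end Coordinates

/-! ### Subgroups of the torus and their dimension. -/

section TorusSubgroups

variable {n : ℕ} {K : Type*} [Field K]

/-- The subgroup of the torus defined by monomial equations. -/
def Torus.monomialSubgroup (K : Type*) [Field K] (t : Finset (Fin n)) (N : Fin n → ℕ)
    (m : Fin n → Fin n → ℤ) : Subgroup (Torus n K) where
  carrier := {y | ∀ j, (y j) ^ N j = ∏ i ∈ t, (y i) ^ m j i}
  one_mem' j := by
    change (1 : Kˣ) ^ N j = ∏ i ∈ t, (1 : Kˣ) ^ m j i
    simp
  mul_mem' {y z} hy hz j := by
    change (y j * z j) ^ N j = ∏ i ∈ t, (y i * z i) ^ m j i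
    simp only [mul_pow, mul_zpow, Finset.prod_mul_distrib, hy j, hz j]
  inv_mem' {y} hy j := by
    change (y j)⁻¹ ^ N j = ∏ i ∈ t, (y i)⁻¹ ^ m j i
    simp only [inv_pow, inv_zpow, Finset.prod_inv_distrib, hy j]

/-- The polynomials over any subfield that cut out `monomialSubgroup`. -/
noncomputable def monomialRelation (k : Type*) [Field k] (t : Finset (Fin n)) (N : Fin n → ℕ)
    (m : Fin n → Fin n → ℤ) (j : Fin n) : MvPolynomial (Fin n) k :=
  -- Negative exponents are moved to the left; `toNat` makes the factor trivial on the side with the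
  -- wrong sign.
  (∏ i ∈ t, X i ^ (-m j i).toNat) * X j ^ N j - ∏ i ∈ t, X i ^ (m j i).toNat

theorem aeval_monomialRelation {k : Type*} [Field k] [Algebra k K] (t : Finset (Fin n))
    (N : Fin n → ℕ) (m : Fin n → Fin n → ℤ) (j : Fin n) (y : Torus n K) :
    aeval y.vec (monomialRelation k t N m j) = 0 ↔ (y j) ^ N j = ∏ i ∈ t, (y i) ^ m j i := by
  have h1 : (∏ i ∈ t, y i ^ m j i) =
      (∏ i ∈ t, y i ^ (-m j i).toNat)⁻¹ * ∏ i ∈ t, y i ^ (m j i).toNat := by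
    rw [← Finset.prod_inv_distrib, ← Finset.prod_mul_distrib]
    refine Finset.prod_congr rfl fun i _ => ?_
    rw [← zpow_natCast, ← zpow_natCast, ← zpow_neg, ← zpow_add]
    congr 1
    omega
  rw [h1, eq_inv_mul_iff_mul_eq, monomialRelation, map_sub, sub_eq_zero, ← Units.val_inj]
  simp only [map_mul, map_prod, map_pow, aeval_X]
  push_cast
  rfl

theorem Torus.isClosed_monomialSubgroup (t : Finset (Fin n)) (N : Fin n → ℕ)
    (m : Fin n → Fin n → ℤ) : IsClosed (Torus.monomialSubgroup K t N m : Set (Torus n K)) := by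
  have : (Torus.monomialSubgroup K t N m : Set (Torus n K)) =
      ⋂ j, {y | aeval y.vec (monomialRelation K t N m j) = 0} := by
    ext y
    simp only [Set.mem_iInter, Set.mem_ofPred_eq, aeval_monomialRelation]
    rfl
  rw [this]
  exact isClosed_iInter fun j => Torus.isZariski_vec.isClosed_setOf_aeval_eq_zero _

/-- A subgroup of the torus on which every coordinate is, up to a power, a monomial in the
coordinates from `t` has dimension at most the cardinality of `t`. -/
theorem Torus.dim_le_card (H : Set (Torus n K)) (t : Finset (Fin n)) (N : Fin n → ℕ)
    (hN : ∀ j, 0 < N j) (m : Fin n → Fin n → ℤ)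
    (h : ∀ y ∈ H, ∀ j, (y j) ^ N j = ∏ i ∈ t, (y i) ^ m j i) : Torus.dim H ≤ t.card := by
  have hJ : Algebra.trdeg K (MvPolynomial (Fin n) K ⧸ vanishing Torus.vec H) ≤ t.card := by
    -- Coordinates are units on the torus, so monomials are nonzerodivisors modulo the vanishing
    -- ideal. Primes avoiding them keep the cofactor in the monomial relation nonzero, which makes X
    -- j algebraic over the coordinates in t.
    refine trdeg_quotient_le _ (Submonoid.closure (Set.range X)) ?_ t ?_
    · intro f hf
      induction hf using Submonoid.closure_induction with
      | one => intro g hg; rwa [one_mul] at hg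
      | mul f₁ f₂ _ _ h₁ h₂ => intro g hg; exact h₂ _ (h₁ _ (by rwa [mul_assoc] at hg))
      | mem f hf =>
        obtain ⟨i, rfl⟩ := hf
        intro g hg
        refine mem_vanishing.2 fun y hy => ?_
        have := mem_vanishing.1 hg y hy
        rw [map_mul, aeval_X] at this
        exact (mul_eq_zero.1 this).resolve_left (y.vec_ne_zero i)
    · intro Q hQ hle hdis j
      set R := Algebra.adjoin K ((fun i => Ideal.Quotient.mk Q (X i)) '' (t : Set (Fin n)))
      have hx : ∀ i ∈ t, Ideal.Quotient.mk Q (X i) ∈ R := fun i hi =>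
        Algebra.subset_adjoin ⟨i, hi, rfl⟩
      have hrel : monomialRelation K t N m j ∈ vanishing (K := K) Torus.vec H :=
        mem_vanishing.2 fun y hy => (aeval_monomialRelation t N m j y).2 (h y hy j)
      have h3 := Ideal.Quotient.eq_zero_iff_mem.2 (hle hrel)
      rw [monomialRelation, map_sub, sub_eq_zero, map_mul, map_pow, map_prod, map_prod] at h3
      simp only [map_pow] at h3
      have hc : ∏ i ∈ t, Ideal.Quotient.mk Q (X i) ^ (-m j i).toNat ≠ 0 :=
        Finset.prod_ne_zero_iff.2 fun i _ => pow_ne_zero _ fun h0 =>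
          hdis _ (Submonoid.subset_closure ⟨i, rfl⟩) (Ideal.Quotient.eq_zero_iff_mem.1 h0)
      have hmem (e : Fin n → ℕ) : ∏ i ∈ t, Ideal.Quotient.mk Q (X i) ^ e i ∈ R :=
        prod_mem fun i hi => pow_mem (hx i hi) _
      refine IsAlgebraic.of_pow (hN j) (IsAlgebraic.of_mul (mem_nonZeroDivisors_of_ne_zero hc)
        (isAlgebraic_algebraMap (⟨_, hmem _⟩ : R)) ?_)
      rw [h3]
      exact isAlgebraic_algebraMap (⟨_, hmem _⟩ : R)
  have h1 := Cardinal.toNat_le_toNat hJ Cardinal.natCast_lt_aleph0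
  rw [Cardinal.toNat_natCast] at h1
  exact h1

/-- A point with multiplicatively independent coordinates lies in no proper closed subgroup. -/
theorem vanishing_eq_bot_of_independent (H : Subgroup (Torus n K)) {b : Torus n K} (hb : b ∈ H)
    (hind : ∀ m : Fin n → ℤ, ∏ i, (b i) ^ m i = 1 → m = 0) :
    vanishing Torus.vec (H : Set (Torus n K)) = ⊥ := by
  rw [eq_bot_iff]
  intro f hf
  -- Each monomial m gives the character N ↦ (b^m)^N of ℤ, and independence of b makes these
  -- distinct. Evaluating f at the powers of b, all in H, gives a linear relation among distinct
  -- characters, so the coefficients of f vanish.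
  let χ : (Fin n →₀ ℕ) → (Multiplicative ℤ →* K) := fun m =>
    (Units.coeHom K).comp (zpowersHom Kˣ (∏ i, (b i) ^ m i))
  have hχ : Function.Injective χ := by
    intro m m' h
    have h1 := DFunLike.congr_fun h (Multiplicative.ofAdd 1)
    have h2 : ∏ i, (b i) ^ m i = ∏ i, (b i) ^ m' i := by
      refine Units.ext ?_
      simpa [χ] using h1
    have h3 := hind (fun i => (m i : ℤ) - m' i) (by
      simp only [zpow_sub, zpow_natCast, Finset.prod_mul_distrib, Finset.prod_inv_distrib, h2]
      simp)
    ext i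
    have := congrFun h3 i
    simp only [Pi.zero_apply] at this
    omega
  have hli := (linearIndependent_monoidHom (Multiplicative ℤ) K).comp χ hχ
  rw [linearIndependent_iff'] at hli
  have h0 := hli f.support (fun m => coeff m f) (by
    funext N
    have h1 := mem_vanishing.1 hf (b ^ Multiplicative.toAdd N) (H.zpow_mem hb _)
    rw [f.as_sum, map_sum] at h1
    simp only [aeval_monomial] at h1
    rw [Finset.sum_apply, Pi.zero_apply, ← h1]
    refine Finset.sum_congr rfl fun m _ => ?_
    change coeff m f * ((((∏ i, (b i) ^ m i) ^ (Multiplicative.toAdd N) : Kˣ)) : K) = _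
    congr 1
    rw [Finsupp.prod_fintype _ _ (fun i => pow_zero _), ← Finset.prod_zpow, Units.coe_prod]
    refine Finset.prod_congr rfl fun i _ => ?_
    rw [← zpow_natCast, ← zpow_mul, mul_comm, zpow_mul, zpow_natCast, Units.val_pow_eq_pow_val]
    rfl)
  rw [Ideal.mem_bot]
  ext m
  by_contra hm
  exact hm (h0 m (mem_support_iff.2 hm))

theorem Torus.le_dim_of_vanishing_eq_bot {H : Set (Torus n K)} (h : vanishing Torus.vec H = ⊥) :
    n ≤ Torus.dim H := by
  have : Torus.dim H = Cardinal.toNat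
    (Algebra.trdeg K (MvPolynomial (Fin n) K ⧸ vanishing Torus.vec H)) := rfl
  rw [this, h, (AlgEquiv.quotientBot K (MvPolynomial (Fin n) K)).trdeg_eq]
  simp

end TorusSubgroups

/-! ### Linear dimension modulo the kernel and multiplicative relations. -/

section LinearDimension

variable {F D : Type*} [Field F] [CharZero F] [AddCommGroup D] [Module ℚ D]

namespace PartialEField

variable (E : PartialEField F D)

theorem e_add (x y : D) : E.e (x + y) = E.e x * E.e y := map_mul E.exp _ _

theorem e_nsmul (N : ℕ) (x : D) : E.e (N • x) = E.e x ^ N := map_pow E.exp _ _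

theorem e_zsmul (m : ℤ) (x : D) : E.e (m • x) = E.e x ^ m := map_zpow E.exp _ _

theorem e_sum {ι : Type*} (s : Finset ι) (x : ι → D) : E.e (∑ i ∈ s, x i) = ∏ i ∈ s, E.e (x i) := by
  rw [e, ofAdd_sum, map_prod]
  rfl

/-- Linear relations modulo the span of the kernel become multiplicative relations. -/
theorem exists_pow_eq_prod_of_mem_span {n : ℕ} (x : Fin n → D) (t : Finset (Fin n)) {y : D}
    (hy : y ∈ Submodule.span ℚ (E.ker ∪ x '' t)) :
    ∃ N : ℕ, 0 < N ∧ ∃ m : Fin n → ℤ, E.e y ^ N = ∏ i ∈ t, E.e (x i) ^ m i := by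
  classical
  induction hy using Submodule.span_induction with
  | mem y hy =>
    rcases hy with hy | ⟨i, hi, rfl⟩
    · exact ⟨1, one_pos, 0, by simpa using (show E.e y = 1 from hy)⟩
    · refine ⟨1, one_pos, Pi.single i 1, ?_⟩
      rw [Finset.prod_eq_single_of_mem i hi]
      · simp
      · intro j _ hj
        simp [hj]
  | zero => exact ⟨1, one_pos, 0, by simpa using (show E.e 0 = 1 from map_one E.exp)⟩
  | add y z _ _ hy hz =>
    obtain ⟨N, hN, m, hm⟩ := hy
    obtain ⟨N', hN', m', hm'⟩ := hz
    refine ⟨N * N', Nat.mul_pos hN hN', fun i => m i * N' + m' i * N, ?_⟩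
    simp only [zpow_add, zpow_mul, Finset.prod_mul_distrib, zpow_natCast, Finset.prod_pow,
      ← hm, ← hm']
    rw [e_add, mul_pow, pow_mul, mul_comm N N', pow_mul]
  | smul q y _ hy =>
    obtain ⟨N, hN, m, hm⟩ := hy
    refine ⟨q.den * N, Nat.mul_pos q.den_pos hN, fun i => m i * q.num, ?_⟩
    simp only [zpow_mul, Finset.prod_zpow, ← hm]
    have h1 : q.den • q • y = q.num • y := by
      rw [← Nat.cast_smul_eq_nsmul ℚ, ← Int.cast_smul_eq_zsmul ℚ, smul_smul, Rat.den_mul_eq_num]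
    rw [pow_mul, ← e_nsmul, h1, e_zsmul, ← zpow_natCast, ← zpow_natCast, ← zpow_mul, ← zpow_mul,
      mul_comm]

end PartialEField

/-- A subfamily that is a basis over `S` of the span of a finite family. -/
theorem exists_linearIndepOn_card_eq_ldim {n : ℕ} (x : Fin n → D) (S : Set D) :
    ∃ t : Finset (Fin n), t.card = ldim (Set.range x) S ∧
      LinearIndepOn ℚ (fun i => (Submodule.span ℚ S).mkQ (x i)) (t : Set (Fin n)) ∧
      ∀ j, x j ∈ Submodule.span ℚ (S ∪ x '' t) := by
  set q := (Submodule.span ℚ S).mkQ with hq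
  obtain ⟨b, -, -, hb, hli⟩ := exists_linearIndepOn_extension
    (v := fun i => q (x i)) (linearIndepOn_empty ℚ _) (Set.empty_subset Set.univ)
  lift b to Finset (Fin n) using b.toFinite
  have himg : (fun i => q (x i)) '' (b : Set (Fin n)) = q '' (x '' b) := by
    rw [Set.image_image]
  refine ⟨b, ?_, hli, fun j => ?_⟩
  · have h1 : Submodule.map q (Submodule.span ℚ (S ∪ Set.range x)) =
        Submodule.span ℚ (Set.range fun i : (b : Set (Fin n)) => q (x i)) := by
      rw [Submodule.map_span, Set.image_union, Submodule.span_union]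
      have h2 : Submodule.span ℚ (q '' S) = ⊥ := by
        rw [Submodule.span_eq_bot]
        rintro _ ⟨s, hs, rfl⟩
        rw [hq, Submodule.mkQ_apply, Submodule.Quotient.mk_eq_zero]
        exact Submodule.subset_span hs
      rw [h2, bot_sup_eq, ← Set.image_eq_range (fun i => q (x i))]
      refine le_antisymm ?_ (Submodule.span_mono ?_)
      · rw [Submodule.span_le]
        rintro _ ⟨_, ⟨i, rfl⟩, rfl⟩
        exact hb ⟨i, trivial, rfl⟩
      · rintro _ ⟨i, -, rfl⟩
        exact ⟨_, ⟨i, rfl⟩, rfl⟩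
    rw [ldim, ← hq, h1, finrank_span_eq_card hli]
    simp
  · have h1 : q (x j) ∈ Submodule.span ℚ (q '' (x '' b)) := by
      rw [← himg]
      exact hb ⟨j, trivial, rfl⟩
    rw [← Submodule.map_span, ← Submodule.mem_comap, hq, Submodule.comap_map_mkQ,
      ← Submodule.span_union] at h1
    exact h1

end LinearDimension

/-! ### Atypicality from a lower bound on transcendence degree. -/

section Geometry

universe u
variable {k K : Type u} [Field k] [Field K] [Algebra k K] {n : ℕ}

/-- Over an algebraically closed k, polynomials vanishing on the K-points of the locus of y lie in
the extension of the ideal of y, so they impose no new relations. -/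
theorem tdeg_le_dim_of_locus_subset [IsAlgClosed k] {σ : Type} [Finite σ] {Y : Type*}
    {c : Y → σ → K} {y : Y} {h : MvPolynomial σ k} (hy : aeval (c y) h ≠ 0)
    (hrange : ∀ q : σ → K, aeval q h ≠ 0 → q ∈ Set.range c) {S : Set Y}
    (hS : locus c (pointIdeal k (c y)) ⊆ S) :
    tdeg k (c y) ≤ AffinePoint.dim (σ := σ) (K := K) (c '' S) := by
  have hprime : (pointIdeal k (c y)).IsPrime := RingHom.ker_isPrime _
  refine tdeg_le_dim ?_
  rw [← vanishing_locus (c := c) (h := h) hy hrange]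
  exact vanishingIdeal_anti_mono (Set.image_mono hS)

theorem GPoint.dim_mono {S T : Set (GPoint n K)} (h : S ⊆ T) : GPoint.dim S ≤ GPoint.dim T :=
  AffinePoint.dim_mono (vanishingIdeal_anti_mono (Set.image_mono h))

theorem Torus.dim_mono {S T : Set (Torus n K)}
    (h : vanishing Torus.vec T ≤ vanishing Torus.vec S) : Torus.dim S ≤ Torus.dim T :=
  AffinePoint.dim_mono h

theorem Torus.vanishing_closure (S : Set (Torus n K)) :
    vanishing Torus.vec (closure S) = vanishing (K := K) Torus.vec S := by
  refine le_antisymm (vanishingIdeal_anti_mono (Set.image_mono subset_closure)) fun f hf => ?_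
  exact mem_vanishing.2 fun y hy => (mem_closure_iff_vanishing Torus.isZariski_vec).1 hy f hf

theorem mem_locus_pointIdeal (k : Type u) [Field k] [Algebra k K] {σ Y : Type*} (c : Y → σ → K)
    (y : Y) : y ∈ locus c (pointIdeal k (c y)) := fun _ hf => hf

/-- The irreducible components of a variety defined over an algebraically closed field `k` are
defined over `k`. -/
theorem IsIrredComponent.exists_eq_locus [IsAlgClosed k]
    {G : Set (MvPolynomial (Fin n ⊕ Fin n) k)} {V W : Set (GPoint n K)}
    (hV : V = {v | ∀ g ∈ G, aeval v.vec g = 0}) (hW : IsIrredComponent W V) :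
    ∃ P : Ideal (MvPolynomial (Fin n ⊕ Fin n) k), P.IsPrime ∧
      W = locus GPoint.vec P ∧ vanishing GPoint.vec W = extendIdeal K P := by
  have hprime := (isIrreducible_iff_isPrime_vanishing GPoint.isZariski_vec).1 hW.1.1
  obtain ⟨v, hv⟩ := hW.1.1.nonempty
  let P : Ideal (MvPolynomial (Fin n ⊕ Fin n) k) :=
    (vanishing GPoint.vec W).comap (map (algebraMap k K))
  have hmem {f} : f ∈ P ↔ ∀ w ∈ W, aeval w.vec f = 0 := by
    rw [Ideal.mem_comap, mem_vanishing]
    simp only [aeval_map_algebraMap]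
  have hP : P.IsPrime := Ideal.comap_isPrime _ _
  have hh : (∏ i, X (Sum.inr i) : MvPolynomial (Fin n ⊕ Fin n) k) ∉ P := fun h =>
    GPoint.aeval_prod_X_ne_zero k v (hmem.1 h v hv)
  have hsub : W ⊆ locus GPoint.vec P := fun w hw f hf => hmem.1 hf w hw
  have hirr : IsIrreducible (locus (K := K) GPoint.vec P) :=
    isIrreducible_locus GPoint.isZariski_vec hh fun q => GPoint.mem_range_vec k
  have heq : W = locus GPoint.vec P := by
    -- The locus of P is irreducible and lies between W and V, so maximality of W forces equality.
    refine hsub.antisymm (hW.2 ⟨hirr, ?_⟩ hsub)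
    intro w hw
    rw [hV]
    intro g hg
    refine hw g (hmem.2 fun w' hw' => ?_)
    have := hW.1.2 hw'
    rw [hV] at this
    exact this g hg
  refine ⟨P, hP, heq, ?_⟩
  conv_lhs => rw [heq]
  exact vanishing_locus hh fun q => GPoint.mem_range_vec k

/-- A polynomial vanishing on pr(W) pulls back into the extension of P. Applying functionals gives
polynomials over k that vanish at pr(v), hence on the whole locus of pr(v). -/
theorem mem_closure_image_mul {P : Ideal (MvPolynomial (Fin n ⊕ Fin n) k)}
    {W : Set (GPoint n K)} (hvan : vanishing GPoint.vec W = extendIdeal K P)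
    {v : GPoint n K} (hv : v ∈ locus GPoint.vec P) :
    locus Torus.vec (pointIdeal k v.mul.vec) ⊆ closure (GPoint.mul '' W) := by
  intro y hy
  rw [mem_closure_iff_vanishing Torus.isZariski_vec]
  intro f hf
  rw [mem_vanishing_image_mul, hvan] at hf
  refine aeval_eq_zero_of_mem_extendIdeal (P := pointIdeal k v.mul.vec) (fun l => ?_) hy
  have h1 := hv _ (hf l)
  rwa [coeffMap_rename, aeval_rename, GPoint.vec_comp_inr] at h1

theorem range_mul_vec_subset (v : GPoint n K) : Set.range v.mul.vec ⊆ Set.range v.vec := by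
  rintro _ ⟨i, rfl⟩
  exact ⟨Sum.inr i, rfl⟩

/-- In a component `W` defined over `k`, the fibre through `v` has dimension at least the
transcendence degree of `v` over `k(pr v)`. -/
theorem tdeg_le_dim_fibre [IsAlgClosed K] {P : Ideal (MvPolynomial (Fin n ⊕ Fin n) k)}
    {v : GPoint n K} (hv : v ∈ locus GPoint.vec P) :
    tdeg (IntermediateField.adjoin k (Set.range v.mul.vec)) v.vec ≤
      GPoint.dim {w | w ∈ locus GPoint.vec P ∧ w.mul = v.mul} := by
  set k' := IntermediateField.adjoin k (Set.range v.mul.vec) with hk'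
  -- The lower bound for dimensions needs an algebraically closed base. The locus of v over k₁ stays
  -- in the fibre because the coordinates of pr(v) are constants of k₁.
  let k₁ := algebraicClosure k' K
  have : IsAlgClosed k₁ := IsAlgClosure.isAlgClosed k'
  have : IsScalarTower k k₁ K := .of_algebraMap_eq fun _ => rfl
  refine (tdeg_le_of_isAlgebraic (k' := k₁) v.vec).trans ?_
  refine tdeg_le_dim_of_locus_subset (GPoint.aeval_prod_X_ne_zero k₁ v)
    (fun q => GPoint.mem_range_vec k₁) fun w hw => ⟨fun f hf => ?_, ?_⟩
  · have := hw (map (algebraMap k k₁) f) (by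
      rw [RingHom.mem_ker, aeval_map_algebraMap]
      exact hv f hf)
    rwa [aeval_map_algebraMap] at this
  · refine Torus.vec_injective (funext fun i => ?_)
    let a : k₁ := algebraMap k' k₁
      ⟨v.mul.vec i, IntermediateField.subset_adjoin k _ ⟨i, rfl⟩⟩
    have := hw (X (Sum.inr i) - C a) (by
      rw [RingHom.mem_ker, map_sub, aeval_X, aeval_C]
      exact sub_self _)
    rw [map_sub, aeval_X, aeval_C, sub_eq_zero] at this
    exact this

/-- The dimension count behind the forward direction: generic fibres absorb only dim W - dim pr(W)
of the transcendence degree of v, and the rest forces a large component of the intersection with the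
monomial subgroup. -/
theorem mem_prAtyp_of_mem_genericFibres [IsAlgClosed k] [IsAlgClosed K]
    {G : Set (MvPolynomial (Fin n ⊕ Fin n) k)} {V : Set (GPoint n K)}
    (hV : V = {v | ∀ g ∈ G, aeval v.vec g = 0}) (hdim : GPoint.dim V < n) {v : GPoint n K}
    (hv : v ∈ genericFibres V) {t : Finset (Fin n)} {N : Fin n → ℕ} (hN : ∀ j, 0 < N j)
    {m : Fin n → Fin n → ℤ} (hvH : v.mul ∈ Torus.monomialSubgroup K t N m)
    (ht : t.card ≤ tdeg k v.vec) : v.mul ∈ prAtyp V := by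
  obtain ⟨W, hW, hvW, hgf⟩ := hv
  obtain ⟨P, hP, rfl, hvan⟩ := hW.exists_eq_locus hV
  set W : Set (GPoint n K) := locus GPoint.vec P
  set H := Torus.monomialSubgroup K t N m
  set B := closure (GPoint.mul '' W)
  have hlocB : locus Torus.vec (pointIdeal k v.mul.vec) ⊆ B := mem_closure_image_mul hvan hvW
  have hlocH : locus Torus.vec (pointIdeal k v.mul.vec) ⊆ (H : Set (Torus n K)) := by
    intro y hy j
    rw [← aeval_monomialRelation (k := k)]
    exact hy _ ((aeval_monomialRelation t N m j v.mul).2 (hvH j))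
  have hb : v.mul ∈ locus Torus.vec (pointIdeal k v.mul.vec) := mem_locus_pointIdeal k _ _
  have hprime : (pointIdeal k v.mul.vec).IsPrime := RingHom.ker_isPrime _
  have hirr : IsIrreducible (locus (K := K) Torus.vec (pointIdeal k v.mul.vec)) :=
    isIrreducible_locus Torus.isZariski_vec (Torus.aeval_prod_X_ne_zero k v.mul)
      fun q => Torus.mem_range_vec k
  -- Irreducible sets are connected, so the whole locus of pr(v) lies in one connected component.
  have hsub := hirr.isPreirreducible.isPreconnected.subset_connectedComponentIn hb
    (Set.subset_inter hlocB hlocH)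
  refine ⟨W, hW, H, Torus.isClosed_monomialSubgroup t N m, _,
    ⟨⟨v.mul, ⟨hlocB hb, hlocH hb⟩, rfl⟩, ?_⟩, hsub hb⟩
  have h1 : tdeg k v.mul.vec ≤
      Torus.dim (connectedComponentIn (B ∩ (H : Set (Torus n K))) v.mul) :=
    tdeg_le_dim_of_locus_subset (Torus.aeval_prod_X_ne_zero k v.mul)
      (fun q => Torus.mem_range_vec k) hsub
  have h2 : _ ≤ GPoint.dim {w | w ∈ W ∧ w.mul = v.mul} := tdeg_le_dim_fibre hvW
  change (GPoint.dim {w | w ∈ W ∧ w.mul = v.mul} : ℤ) =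
    GPoint.dim W - Torus.dim (GPoint.mul '' W) at hgf
  have h3 := tdeg_eq_add (k := k) v.vec v.mul.vec (range_mul_vec_subset v)
  have h4 : Torus.dim (H : Set (Torus n K)) ≤ t.card :=
    Torus.dim_le_card _ t N hN m fun y hy => hy
  have h5 : Torus.dim B ≤ Torus.dim (GPoint.mul '' W) :=
    Torus.dim_mono (Torus.vanishing_closure _).ge
  have h6 : GPoint.dim W ≤ GPoint.dim V := GPoint.dim_mono hW.1.2
  change (Torus.dim (connectedComponentIn (B ∩ (H : Set (Torus n K))) v.mul) : ℤ) >
    Torus.dim B + Torus.dim (H : Set (Torus n K)) - n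
  omega

end Geometry

/-! ### A point is generic in its own locus. -/

section Generic

universe u
variable {k K : Type u} [Field k] [Field K] [Algebra k K] {n : ℕ}

theorem dim_locus_pointIdeal_le (k : Type u) [Field k] [Algebra k K] (v : GPoint n K) :
    GPoint.dim (locus (K := K) GPoint.vec (pointIdeal k v.vec)) ≤ tdeg k v.vec :=
  dim_le_tdeg (by
    rintro _ ⟨w, hw, rfl⟩
    exact hw)

/-- A relation of v over k(pr v) becomes, after clearing denominators and replacing each generator
by the coordinate it equals, a relation over k. It therefore holds on the locus, and on the fibre it
specializes back to the original relation. -/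
theorem dim_fibre_le_tdeg (v : GPoint n K) :
    GPoint.dim {w | w ∈ locus GPoint.vec (pointIdeal k v.vec) ∧ w.mul = v.mul} ≤
      tdeg (IntermediateField.adjoin k (Set.range v.mul.vec)) v.vec := by
  refine dim_le_tdeg ?_
  rintro _ ⟨w, ⟨hw, hmul⟩, rfl⟩ f hf
  obtain ⟨d, hd, g, hg⟩ := exists_clear_denominators (K := K) _ f
  choose idx hidx using fun y : Set.range v.mul.vec => y.2
  have key (w : GPoint n K) (hmul : w.mul = v.mul) :
      aeval w.vec (rename (Sum.elim id (Sum.inr ∘ idx)) g) =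
        aeval (fun y : Set.range v.mul.vec => algebraMap K K y) d * aeval w.vec f := by
    rw [aeval_rename, ← hg]
    congr 1
    congr 1
    funext i
    rcases i with i | y
    · rfl
    · exact (congrArg (fun b => Torus.vec b (idx y)) hmul).trans (hidx y)
  have h1 := hw (rename (Sum.elim id (Sum.inr ∘ idx)) g) (by
    rw [RingHom.mem_ker, key v rfl, RingHom.mem_ker.1 hf, mul_zero])
  rw [key w hmul] at h1
  exact (mul_eq_zero.1 h1).resolve_left hd

theorem isIntegral_map_algebraMap (k k' σ : Type*) [Field k] [Field k'] [Algebra k k']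
    [Algebra.IsAlgebraic k k'] :
    (map (σ := σ) (algebraMap k k')).IsIntegral := by
  intro f
  induction f using MvPolynomial.induction_on with
  | C a =>
    obtain ⟨p, hp, hpa⟩ := Algebra.IsIntegral.isIntegral (R := k) a
    refine ⟨p.map C, hp.map _, ?_⟩
    rw [Polynomial.eval₂_map, map_comp_C, ← Polynomial.hom_eval₂, hpa, map_zero]
  | add f g hf hg => exact hf.add _ hg
  | mul_X f i hf =>
    refine hf.mul _ ?_
    rw [← map_X (algebraMap k k')]
    exact RingHom.isIntegralElem_map _

/-- The locus over the relative algebraic closure k₀ is irreducible. It is maximal by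
incomparability of primes: an irreducible set between the two loci yields a prime inside the ideal
of v over k₀ with the same contraction to k, and the extension of polynomial rings is integral. -/
theorem isIrredComponent_locus [IsAlgClosed K] (v : GPoint n K) :
    IsIrredComponent (locus (K := K) GPoint.vec (pointIdeal (algebraicClosure k K) v.vec))
      (locus GPoint.vec (pointIdeal k v.vec)) := by
  set k₀ := algebraicClosure k K
  have : IsAlgClosed k₀ := IsAlgClosure.isAlgClosed k
  have hP : (pointIdeal k₀ v.vec).IsPrime := RingHom.ker_isPrime _
  have hirr : IsIrreducible (locus (K := K) GPoint.vec (pointIdeal k₀ v.vec)) :=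
    isIrreducible_locus GPoint.isZariski_vec (GPoint.aeval_prod_X_ne_zero k₀ v)
      fun q => GPoint.mem_range_vec k₀
  have hsub : locus (K := K) GPoint.vec (pointIdeal k₀ v.vec) ⊆
      locus GPoint.vec (pointIdeal k v.vec) := fun w hw f hf => by
    have := hw (map (algebraMap k k₀) f) (by rwa [RingHom.mem_ker, aeval_map_algebraMap])
    rwa [aeval_map_algebraMap] at this
  refine ⟨⟨hirr, hsub⟩, ?_⟩
  rintro Z ⟨hZ, hZV⟩ hWZ
  have hZprime := (isIrreducible_iff_isPrime_vanishing GPoint.isZariski_vec).1 hZ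
  let Q : Ideal (MvPolynomial (Fin n ⊕ Fin n) k₀) :=
    (vanishing GPoint.vec Z).comap (map (algebraMap k₀ K))
  have hmem {f} : f ∈ Q ↔ ∀ w ∈ Z, aeval w.vec f = 0 := by
    rw [Ideal.mem_comap, mem_vanishing]
    simp only [aeval_map_algebraMap]
  have hQ : Q.IsPrime := Ideal.comap_isPrime _ _
  have hle : Q ≤ pointIdeal k₀ v.vec := fun f hf =>
    hmem.1 hf v (hWZ (mem_locus_pointIdeal k₀ _ _))
  have heq : Q = pointIdeal k₀ v.vec := by
    by_contra hne
    let φ := map (σ := Fin n ⊕ Fin n) (algebraMap k k₀)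
    let _ := φ.toAlgebra
    have : Algebra.IsIntegral (MvPolynomial (Fin n ⊕ Fin n) k) (MvPolynomial (Fin n ⊕ Fin n) k₀) :=
      ⟨isIntegral_map_algebraMap k k₀ _⟩
    have hlt : Q.comap φ < (pointIdeal k₀ v.vec).comap φ :=
      Ideal.IsIntegral.comap_lt_comap (lt_of_le_of_ne hle hne)
    refine hlt.not_ge fun f hf => ?_
    rw [Ideal.mem_comap, RingHom.mem_ker, aeval_map_algebraMap] at hf
    rw [Ideal.mem_comap, hmem]
    intro w hw
    rw [aeval_map_algebraMap]
    exact hZV hw f hf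
  intro w hw f hf
  rw [← heq] at hf
  exact hmem.1 hf w hw

/-- Over k₀ the dimensions of the component, of its projection and of the fibre through v are
exactly the transcendence degrees of v, of pr(v), and of v over k₀(pr v), which add up. -/
theorem mem_genericFibres_locus [IsAlgClosed K] (v : GPoint n K) :
    v ∈ genericFibres (locus (K := K) GPoint.vec (pointIdeal k v.vec)) := by
  set k₀ := algebraicClosure k K
  have : IsAlgClosed k₀ := IsAlgClosure.isAlgClosed k
  have hv := mem_locus_pointIdeal k₀ GPoint.vec v
  refine ⟨_, isIrredComponent_locus v, hv, ?_⟩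
  set W : Set (GPoint n K) := locus GPoint.vec (pointIdeal k₀ v.vec)
  have hP : (pointIdeal k₀ v.vec).IsPrime := RingHom.ker_isPrime _
  have hvan : vanishing GPoint.vec W = extendIdeal K (pointIdeal k₀ v.vec) :=
    vanishing_locus (GPoint.aeval_prod_X_ne_zero k₀ v) fun q => GPoint.mem_range_vec k₀
  have h1 : GPoint.dim {w | w ∈ W ∧ w.mul = v.mul} ≤ _ := dim_fibre_le_tdeg (k := k₀) v
  have h2 : _ ≤ GPoint.dim {w | w ∈ W ∧ w.mul = v.mul} := tdeg_le_dim_fibre (k := k₀) hv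
  have h3 : GPoint.dim W ≤ tdeg k₀ v.vec := dim_locus_pointIdeal_le k₀ v
  have h4 : tdeg k₀ v.vec ≤ GPoint.dim W :=
    tdeg_le_dim_of_locus_subset (GPoint.aeval_prod_X_ne_zero k₀ v)
      (fun q => GPoint.mem_range_vec k₀) subset_rfl
  have h5 : Torus.dim (GPoint.mul '' W) ≤ tdeg k₀ v.mul.vec := dim_le_tdeg (by
    rintro _ ⟨_, ⟨w, hw, rfl⟩, rfl⟩ f hf
    have := hw (rename Sum.inr f) (by
      rwa [RingHom.mem_ker, aeval_rename, GPoint.vec_comp_inr])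
    rwa [aeval_rename, GPoint.vec_comp_inr] at this)
  have h6 : tdeg k₀ v.mul.vec ≤ Torus.dim (GPoint.mul '' W) := tdeg_le_dim fun f hf l => by
    have hf' := (mem_vanishing_image_mul W f).1 hf
    rw [hvan] at hf'
    have := hf' l
    rwa [coeffMap_rename, RingHom.mem_ker, aeval_rename, GPoint.vec_comp_inr] at this
  have h7 := tdeg_eq_add (k := k₀) v.vec v.mul.vec (range_mul_vec_subset v)
  omega

/-- A subgroup through b has dimension at least n, so atypicality would make a subset of B larger in
dimension than B. -/
theorem notMem_atyp_of_independent {b : Torus n K}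
    (hind : ∀ m : Fin n → ℤ, ∏ i, (b i) ^ m i = 1 → m = 0) (B : Set (Torus n K)) : b ∉ atyp B := by
  rintro ⟨H, -, X, ⟨⟨y, -, rfl⟩, hdim⟩, hb⟩
  have hsub := connectedComponentIn_subset (B ∩ (H : Set (Torus n K))) y
  have h1 := Torus.le_dim_of_vanishing_eq_bot
    (vanishing_eq_bot_of_independent H (hsub hb).2 hind)
  have h2 := Torus.dim_mono (vanishingIdeal_anti_mono
    (Set.image_mono (f := (Torus.vec : Torus n K → _)) (hsub.trans Set.inter_subset_left)))
  omega

end Generic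

/-! ### Transcendence degrees in F and in its extension K. -/

section Comparison

universe u
variable {F K : Type u} [Field F] [CharZero F] [Field K] [Algebra F K]

theorem td_range_eq_tdeg {σ : Type*} (p : σ → F) (S : Set F) :
    td (Set.range p) S =
      tdeg (IntermediateField.adjoin ℚ S) fun i => algebraMap F K (p i) := by
  let k := IntermediateField.adjoin ℚ S
  let L := IntermediateField.adjoin k (Set.range p)
  let φ : F →ₐ[k] K := IsScalarTower.toAlgHom k F K
  have h : L.map φ = IntermediateField.adjoin k (Set.range fun i => algebraMap F K (p i)) := by
    rw [IntermediateField.adjoin_map, ← Set.range_comp]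
    rfl
  have h1 := ((L.equivMap φ).trans (IntermediateField.equivOfEq h)).trdeg_eq
  exact congrArg Cardinal.toNat h1

theorem tdeg_mono {k : Type u} [Field k] [Algebra k K] {σ τ : Type*} [Finite τ]
    {p : σ → K} {q : τ → K} (h : Set.range p ⊆ Set.range q) : tdeg k p ≤ tdeg k q :=
  Cardinal.toNat_le_toNat
    (trdeg_le_of_injective (IntermediateField.inclusion (IntermediateField.adjoin.mono k _ _ h))
      (IntermediateField.inclusion_injective _))
    (trdeg_adjoin_lt_aleph0 q)

end Comparison

/-! ### Loci as fibres of families over ℚ. -/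

section Family

universe u
variable {F K : Type u} [Field F] [CharZero F] [Field K] [CharZero K] [Algebra F K] {n : ℕ}

theorem mem_familyFibre {m : ℕ} {I : Ideal (MvPolynomial ((Fin n ⊕ Fin n) ⊕ Fin m) ℚ)}
    {p : Fin m → K} {v : GPoint n K} :
    v ∈ familyFibre I p ↔ ∀ g ∈ I, aeval (Sum.elim v.vec p) g = 0 := Iff.rfl

omit [CharZero F] in
/-- Specializing some variables to constants does not change values. -/
theorem aeval_aeval_sumElim {k : Type*} [Field k] [CharZero k] [Algebra k K] {σ τ : Type*}
    (p : τ → k) (q : σ → K) (g : MvPolynomial (σ ⊕ τ) ℚ) :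
    aeval q (aeval (Sum.elim X fun j => C (p j)) g : MvPolynomial σ k) =
      aeval (Sum.elim q fun j => algebraMap k K (p j)) g := by
  induction g using MvPolynomial.induction_on with
  | C a =>
    rw [aeval_C, aeval_C, IsScalarTower.algebraMap_apply ℚ k (MvPolynomial σ k), algebraMap_eq,
      aeval_C, eq_ratCast, eq_ratCast, map_ratCast]
  | add f g hf hg => simp only [map_add, hf, hg]
  | mul_X f i hf =>
    rw [map_mul, map_mul, hf, map_mul, aeval_X, aeval_X]
    rcases i with i | i <;> simp

/-- A fibre of a family over `ℚ` at parameters from a field `k` is defined over `k`. -/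
theorem familyFibre_eq_setOf {k : Type*} [Field k] [CharZero k] [Algebra k K] {m : ℕ}
    (I : Ideal (MvPolynomial ((Fin n ⊕ Fin n) ⊕ Fin m) ℚ)) (p : Fin m → k) :
    familyFibre I (fun j => algebraMap k K (p j)) =
      {v : GPoint n K | ∀ g ∈ (aeval (Sum.elim X fun j => C (p j)) :
        MvPolynomial ((Fin n ⊕ Fin n) ⊕ Fin m) ℚ → MvPolynomial (Fin n ⊕ Fin n) k) '' I,
          aeval v.vec g = 0} := by
  ext v
  rw [mem_familyFibre, Set.mem_ofPred_eq, Set.forall_mem_image]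
  simp only [aeval_aeval_sumElim]
  rfl

/-- The locus of a point over the field generated by `S` is a fibre of a family over `ℚ` at
finitely many parameters from `S`. -/
theorem exists_familyFibre_eq_locus (S : Set F) (v : GPoint n K) :
    ∃ (m : ℕ) (κ : Fin m → F) (I : Ideal (MvPolynomial ((Fin n ⊕ Fin n) ⊕ Fin m) ℚ)),
      (∀ j, κ j ∈ S) ∧ familyFibre I (fun j => algebraMap F K (κ j)) =
        locus GPoint.vec (pointIdeal (IntermediateField.adjoin ℚ S) v.vec) := by
  classical
  let sp : MvPolynomial ((Fin n ⊕ Fin n) ⊕ S) ℚ → MvPolynomial (Fin n ⊕ Fin n) F :=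
    aeval (Sum.elim X fun s : S => C (s : F))
  let A : Set (MvPolynomial ((Fin n ⊕ Fin n) ⊕ S) ℚ) :=
    {g | aeval (Sum.elim v.vec fun s : S => algebraMap F K s) g = 0}
  -- A collects all rational relations between v and elements of S. By Hilbert's basis theorem,
  -- finitely many of them generate, after specialization, the same ideal over F.
  obtain ⟨B', hB', hspan⟩ := (Submodule.fg_span_iff_fg_span_finset_subset _).1
    (IsNoetherian.noetherian (Ideal.span (sp '' A)))
  obtain ⟨B, hBA, rfl⟩ := Finset.subset_set_image_iff.1 hB'
  -- Only the finitely many elements of S occurring in these generators are needed as parameters.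
  let Z : Finset S := (B.biUnion vars).preimage Sum.inr Sum.inr_injective.injOn
  let κ : Fin Z.card → S := fun j => Z.equivFin.symm j
  have hκ : Function.Injective κ := Subtype.val_injective.comp Z.equivFin.symm.injective
  have hren : ∀ g ∈ B, ∃ g', rename (Sum.map id κ) g' = g := by
    intro g hg
    refine exists_rename_eq_of_vars_subset_range g _ (Sum.map_injective.2
      ⟨Function.injective_id, hκ⟩) ?_
    rintro (i | s) hs
    · exact ⟨Sum.inl i, rfl⟩
    · have hsZ : s ∈ Z := Finset.mem_preimage.2 (Finset.mem_biUnion.2 ⟨g, hg, hs⟩)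
      exact ⟨Sum.inr (Z.equivFin ⟨s, hsZ⟩), by simp [κ]⟩
  have hcomp (w : GPoint n K) : (Sum.elim w.vec fun s : S => algebraMap F K s) ∘ Sum.map id κ =
      Sum.elim w.vec fun j => algebraMap F K (κ j) := by
    rw [Sum.elim_comp_map]
    rfl
  refine ⟨Z.card, fun j => κ j,
    RingHom.ker (aeval (R := ℚ) (Sum.elim v.vec fun j => algebraMap F K (κ j))),
    fun j => (κ j).2, Set.Subset.antisymm ?_ ?_⟩
  · intro w hw f hf
    rw [mem_familyFibre] at hw
    obtain ⟨d, hd, g, hg⟩ := exists_clear_denominators (K := K) S f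
    have hgA : g ∈ A := by
      change aeval _ g = 0
      rw [hg, RingHom.mem_ker.1 hf, mul_zero]
    have hker : Ideal.span (sp '' A) ≤ RingHom.ker (aeval (R := F) w.vec) := by
      refine hspan.trans_le (Ideal.span_le.2 ?_)
      rw [Finset.coe_image]
      rintro _ ⟨b, hb, rfl⟩
      obtain ⟨b', rfl⟩ := hren b hb
      have h1 := hBA hb
      change aeval _ (rename _ b') = 0 at h1
      rw [aeval_rename, hcomp] at h1
      change aeval w.vec (sp (rename _ b')) = 0
      rw [aeval_aeval_sumElim, aeval_rename, hcomp]
      exact hw b' h1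
    have h2 : aeval w.vec (sp g) = 0 := hker (Ideal.subset_span ⟨g, hgA, rfl⟩)
    rw [aeval_aeval_sumElim, hg] at h2
    exact (mul_eq_zero.1 h2).resolve_left hd
  · intro w hw
    rw [mem_familyFibre]
    intro g hg
    let p : Fin Z.card → IntermediateField.adjoin ℚ S := fun j =>
      ⟨κ j, IntermediateField.subset_adjoin ℚ S (κ j).2⟩
    have h1 := hw (aeval (Sum.elim X fun j => C (p j)) g) (by
      rw [RingHom.mem_ker, aeval_aeval_sumElim]
      exact hg)
    rw [aeval_aeval_sumElim] at h1
    exact h1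

end Family

/-! ### The two implications. -/

namespace PartialEField

variable {F D : Type*} [Field F] [CharZero F] [AddCommGroup D] [Module ℚ D]
  (E : PartialEField F D)

/-- The field generated by the kernel. -/
noncomputable abbrev kerField : IntermediateField ℚ F :=
  IntermediateField.adjoin ℚ (E.incl '' E.ker)

theorem td_graph_eq_tdeg {n : ℕ} (x : Fin n → D) :
    td (Set.range (fun i => E.incl (x i)) ∪ Set.range (fun i => (E.e (x i) : F)))
      (E.incl '' E.ker) = tdeg E.kerField (E.graphPoint x).vec := by
  have h : (E.graphPoint x).vec = fun i => algebraMap F (AlgebraicClosure F)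
      (Sum.elim (fun i => E.incl (x i)) (fun i => (E.e (x i) : F)) i) := by
    funext i
    rcases i with i | i <;> rfl
  rw [← Set.Sum.elim_range, td_range_eq_tdeg (K := AlgebraicClosure F), h]

theorem strongKernelScheme_of_hasStrongKernel (h : E.HasStrongKernel) :
    E.StrongKernelScheme := by
  intro n m I κ hκ x
  by_contra! hcon
  obtain ⟨hdim, hgf, hnot⟩ := hcon
  obtain ⟨t, ht, -, hspan⟩ := exists_linearIndepOn_card_eq_ldim x E.ker
  choose N hN a ha using fun j => E.exists_pow_eq_prod_of_mem_span x t (hspan j)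
  let K := AlgebraicClosure F
  -- The fibre has parameters in the kernel field; passing to its algebraic closure makes the
  -- components defined over k without lowering the transcendence degree.
  let k := algebraicClosure E.kerField K
  have : IsAlgClosed k := IsAlgClosure.isAlgClosed E.kerField
  have : IsScalarTower E.kerField k K := .of_algebraMap_eq fun _ => rfl
  let p : Fin m → k := fun j => algebraMap E.kerField k
    ⟨E.incl (κ j), IntermediateField.subset_adjoin ℚ _ ⟨_, hκ j, rfl⟩⟩
  have hV : E.fibreAt (n := n) I κ = _ := familyFibre_eq_setOf (K := K) I p
  refine hnot (mem_prAtyp_of_mem_genericFibres (k := k) (t := t) hV hdim hgf hN (m := a) ?_ ?_)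
  · intro j
    have := congrArg (Units.map (algebraMap F K).toMonoidHom) (ha j)
    simp only [map_pow, map_prod, map_zpow] at this
    exact this
  · refine le_trans ?_ (tdeg_le_of_isAlgebraic (k := E.kerField) (k' := k) _)
    rw [← td_graph_eq_tdeg, ht]
    have := h n x
    rw [predim] at this
    omega

theorem hasStrongKernel_of_strongKernelScheme (h : E.StrongKernelScheme) :
    E.HasStrongKernel := by
  intro n x
  by_contra! hneg
  obtain ⟨t, ht, hli, -⟩ := exists_linearIndepOn_card_eq_ldim x E.ker
  -- Restricting to a basis modulo the kernel keeps the linear dimension and cannot raise the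
  -- transcendence degree, so the predimension stays negative.
  let s := t.orderEmbOfFin rfl
  let x' : Fin t.card → D := fun i => x (s i)
  let v := E.graphPoint x'
  have htd : tdeg E.kerField v.vec < t.card := by
    have h1 : tdeg E.kerField v.vec ≤ tdeg E.kerField (E.graphPoint x).vec := by
      refine tdeg_mono ?_
      rintro _ ⟨i | i, rfl⟩
      · exact ⟨Sum.inl (s i), rfl⟩
      · exact ⟨Sum.inr (s i), rfl⟩
    rw [predim, td_graph_eq_tdeg] at hneg
    omega
  obtain ⟨m, κ, I, hκ, hV⟩ := exists_familyFibre_eq_locus (E.incl '' E.ker) v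
  choose κ' hκ' hκκ' using hκ
  obtain rfl : (fun j => E.incl (κ' j)) = κ := funext hκκ'
  -- A multiplicative relation among the exponentials puts an integer combination of the subtuple in
  -- the kernel, so linear independence modulo the kernel makes it trivial.
  have hind : ∀ a : Fin t.card → ℤ, ∏ i, (E.expPoint x' i) ^ a i = 1 → a = 0 := by
    intro a ha
    have h1 : E.e (∑ i, a i • x' i) = 1 := by
      refine Units.map_injective (f := (algebraMap F (AlgebraicClosure F)).toMonoidHom)
        (algebraMap F (AlgebraicClosure F)).injective ?_
      rw [e_sum, map_one, map_prod, ← ha]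
      refine Finset.prod_congr rfl fun i _ => ?_
      rw [e_zsmul, map_zpow]
      rfl
    have h2 : (Submodule.span ℚ E.ker).mkQ (∑ i, a i • x' i) = 0 :=
      (Submodule.Quotient.mk_eq_zero _).2 (Submodule.subset_span h1)
    have hli' : LinearIndependent ℚ fun i => (Submodule.span ℚ E.ker).mkQ (x' i) :=
      LinearIndependent.comp hli (fun i => ⟨s i, t.orderEmbOfFin_mem rfl i⟩)
        fun i j hij => s.injective (congrArg Subtype.val hij)
    rw [Fintype.linearIndependent_iff] at hli'
    have h3 := hli' (fun i => (a i : ℚ)) (by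
      rw [← h2, map_sum]
      refine Finset.sum_congr rfl fun i _ => ?_
      rw [map_zsmul, Int.cast_smul_eq_zsmul])
    funext i
    exact_mod_cast h3 i
  have hV' : E.fibreAt I κ' = locus GPoint.vec (pointIdeal E.kerField v.vec) := hV
  rcases h _ m I κ' hκ' x' with h1 | h1 | h1
  · rw [hV'] at h1
    have := dim_locus_pointIdeal_le E.kerField v
    omega
  · rw [hV'] at h1
    exact h1 (mem_genericFibres_locus v)
  · obtain ⟨W, -, hW⟩ := h1
    exact notMem_atyp_of_independent hind _ hW

end PartialEField

end EField

theorem mainTheorem4 {F D : Type*} [Field F] [CharZero F] [AddCommGroup D] [Module ℚ D]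
    (E : EField.PartialEField F D) :
    E.HasStrongKernel ↔ E.StrongKernelScheme :=
  ⟨E.strongKernelScheme_of_hasStrongKernel, E.hasStrongKernel_of_strongKernelScheme⟩
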